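/- Let $\Omega\subset\mathbb{R}^3$ be a bounded domain (open, connected, bounded) with Lipschitz boundary: $\partial\Omega$ is covered by finitely many open sets $U_m$ such that each $\overline{U_m}\cap\overline{\Omega}$ is the image of the closed half-ball $\{y\in\mathbb{R}^3 : |y|\le 1,\ y_3\ge 0\}$ under a homeomorphism which is Lipschitz together with its inverse, and which maps the flat face $\{|y|\le 1,\ y_3=0\}$ onto $\overline{U_m}\cap\partial\Omega$. Let $W^{k,p}(\Omega)$ be the Sobolev space of real functions whose weak derivatives up to order $k$ exist and lie in $L^p(\Omega)$; spaces of tensor fields are understood entrywise. For a $3\times3$ tensor field $\mathsf{B}=(b_{ij})$ let $D^k\mathsf{B}$ be the family of all weak derivatives $D^{\boldsymbol\gamma}b_{ij}$ with $|\boldsymbol\gamma|=k$ ($D=D^1$), and let the $L^p(\Omega)$ norm of a finite family $(f_\iota)$ be $\left(\sum_\iota\|f_\iota\|_{L^p(\Omega)}^p\right)^{1/p}$ if $p<\infty$ and $\max_\iota\|f_\iota\|_{L^\infty(\Omega)}$ if $p=\infty$. There is a universal constant $c$ (independent of $\Omega$ and of $\mathsf{B}$) such that the following holds. If $\mathsf{B}\in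 W^{2,3}(\Omega)^{3\times3}$ and $\det\mathsf{B}=1$ almost everywhere on $\Omega$, then $\mathsf{B}^{-1}\in W^{2,3}(\Omega)^{3\times 3}$, the norms $\|D\mathsf{B}\|_{L^6(\Omega)}$, $\|\mathsf{B}\|_{L^\infty(\Omega)}$ and $\|D^2\mathsf{B}\|_{L^3(\Omega)}$ are finite, and $$\|D^2(\mathsf{B}^{-1})\|_{L^3(\Omega)}\le c\left(\|D\mathsf{B}\|_{L^6(\Omega)}^2+\|\mathsf{B}\|_{L^\infty(\Omega)}\|D^2\mathsf{B}\|_{L^3(\Omega)}\right).$$ If, moreover, $\mu_1,\mu_2,\mu_3\in W^{1,\infty}(\Omega)\cap W^{2,3}(\Omega)$ are real-valued, then $$\mathcal{A}(\mathsf{B})=\mu_1\mathsf{I}+\mu_2\mathsf{B}+\mu_3\mathsf{B}^{-1}\in W^{2,3}(\Omega)^{3\times3}.$$ -/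

import Mathlib

open MeasureTheory Set
open scoped ENNReal NNReal

namespace TensorSobolev

noncomputable section

/-- Three-dimensional Euclidean space. -/
abbrev E3 : Type := EuclideanSpace ℝ (Fin 3)

/-- Real `3 × 3` matrices, the values of a tensor field. -/
abbrev Mat3 : Type := Matrix (Fin 3) (Fin 3) ℝ

/-! ### Sobolev spaces on an open set -/

/-- The classical partial derivative in the direction of the `i`-th coordinate. -/
def partialDeriv (i : Fin 3) (φ : E3 → ℝ) : E3 → ℝ :=
  fun x => fderiv ℝ φ x (EuclideanSpace.single i 1)

/-- The classical derivative `∂₀^(γ 0) ∂₁^(γ 1) ∂₂^(γ 2) φ` for a multi-index `γ`. -/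
def multiDeriv (γ : Fin 3 → ℕ) (φ : E3 → ℝ) : E3 → ℝ :=
  (partialDeriv 0)^[γ 0] ((partialDeriv 1)^[γ 1] ((partialDeriv 2)^[γ 2] φ))

/-- Test functions on `Ω`: smooth, with compact support contained in `Ω`. -/
def IsTestFunction (Ω : Set E3) (φ : E3 → ℝ) : Prop :=
  ContDiff ℝ ((⊤ : ℕ∞) : WithTop ℕ∞) φ ∧ HasCompactSupport φ ∧ tsupport φ ⊆ Ω

/-- `g` is the weak derivative `D^γ u` on `Ω`; both functions are locally integrable in `Ω`. -/
def IsWeakDeriv (Ω : Set E3) (γ : Fin 3 → ℕ) (u g : E3 → ℝ) : Prop :=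
  LocallyIntegrableOn u Ω ∧ LocallyIntegrableOn g Ω ∧
    ∀ φ : E3 → ℝ, IsTestFunction Ω φ →
      ∫ x in Ω, u x * multiDeriv γ φ x = (-1) ^ (∑ i, γ i) * ∫ x in Ω, g x * φ x

/-- `u ∈ W^{k,p}(Ω)`: `u ∈ L^p(Ω)`, and all weak derivatives of order at most `k` exist and
belong to `L^p(Ω)`. -/
def MemW (Ω : Set E3) (k : ℕ) (p : ℝ≥0∞) (u : E3 → ℝ) : Prop :=
  MemLp u p (volume.restrict Ω) ∧
    ∀ γ : Fin 3 → ℕ, ∑ i, γ i ≤ k →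
      ∃ g : E3 → ℝ, IsWeakDeriv Ω γ u g ∧ MemLp g p (volume.restrict Ω)

/-- `B ∈ W^{k,p}(Ω)^{3×3}`: every entry belongs to `W^{k,p}(Ω)`. -/
def MemWTensor (Ω : Set E3) (k : ℕ) (p : ℝ≥0∞) (B : E3 → Mat3) : Prop :=
  ∀ i j, MemW Ω k p (fun x => B x i j)

open Classical in
/-- A representative of the weak derivative `D^γ u` on `Ω` (unique up to equality almost everywhere
in an open set `Ω`); by convention `0` if there is no weak derivative. -/
def weakDeriv (Ω : Set E3) (γ : Fin 3 → ℕ) (u : E3 → ℝ) : E3 → ℝ :=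
  if h : ∃ g, IsWeakDeriv Ω γ u g then h.choose else 0

/-- The `L^p(Ω)` norm of a finite family of functions: `(∑ ‖f i‖_p ^ p) ^ (1 / p)` if `p < ∞`, and
the largest of the `‖f i‖_∞` if `p = ∞`. -/
def familyNorm {ι : Type} [Fintype ι] (Ω : Set E3) (p : ℝ≥0∞) (f : ι → E3 → ℝ) : ℝ≥0∞ :=
  if p = ∞ then ⨆ i, eLpNorm (f i) ∞ (volume.restrict Ω)
  else (∑ i, eLpNorm (f i) p (volume.restrict Ω) ^ p.toReal) ^ (1 / p.toReal)

/-- `‖B‖_{L^p(Ω)}` for a tensor field `B`. -/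
def tensorNorm (Ω : Set E3) (p : ℝ≥0∞) (B : E3 → Mat3) : ℝ≥0∞ :=
  familyNorm Ω p (fun (e : Fin 3 × Fin 3) x => B x e.1 e.2)

/-- `‖D^k B‖_{L^p(Ω)}` for a tensor field `B`, where `D^k B` is the family of the weak derivatives
`D^γ B_ij` over all entries `i, j` and all multi-indices `γ` of order `k`. -/
def derivNorm (Ω : Set E3) (k : ℕ) (p : ℝ≥0∞) (B : E3 → Mat3) : ℝ≥0∞ :=
  familyNorm Ω p
    (fun e : (Fin 3 × Fin 3) × (Finset.piAntidiag Finset.univ k : Finset (Fin 3 → ℕ)) =>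
      weakDeriv Ω e.2 (fun x => B x e.1.1 e.1.2))

/-! ### Lipschitz boundaries -/

/-- The closed half-ball. -/
def halfBall : Set E3 := {y | ‖y‖ ≤ 1 ∧ 0 ≤ y 2}

/-- The flat face of the closed half-ball. -/
def flatFace : Set E3 := {y | ‖y‖ ≤ 1 ∧ y 2 = 0}

/-- `∂Ω` is covered by finitely many open sets `U m`, such that each `closure (U m) ∩ closure Ω`
is the image of the closed half-ball under a homeomorphism `Φ m` that is Lipschitz together with
its inverse, with a constant `K` independent of `m`, and `closure (U m) ∩ ∂Ω` is the image of the
flat face. -/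
def HasLipschitzBoundary (Ω : Set E3) : Prop :=
  ∃ (M : ℕ) (U : Fin M → Set E3) (Φ : Fin M → E3 → E3) (K : ℝ),
    (∀ m, IsOpen (U m)) ∧ frontier Ω ⊆ ⋃ m, U m ∧
    ∀ m,
      (∀ y ∈ halfBall, ∀ z ∈ halfBall,
        dist (Φ m y) (Φ m z) ≤ K * dist y z ∧ dist y z ≤ K * dist (Φ m y) (Φ m z)) ∧
      Φ m '' halfBall = closure (U m) ∩ closure Ω ∧
      Φ m '' flatFace = closure (U m) ∩ frontier Ω

/-! ### The constitutive tensor -/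

/-- `𝒜(B) = μ₁ I + μ₂ B + μ₃ B⁻¹`, pointwise. -/
def calA (μ₁ μ₂ μ₃ : E3 → ℝ) (B : E3 → Mat3) : E3 → Mat3 :=
  fun x => μ₁ x • (1 : Mat3) + μ₂ x • B x + μ₃ x • (B x)⁻¹

end

end TensorSobolev

namespace TensorSobolev

/-! ### Classical partial derivatives -/

/-! Where `det B = 1` the inverse is the adjugate, so every entry of `B⁻¹` is a difference of two
products of entries of `B`. All claims therefore reduce to one fact: on a bounded Lipschitz domain,
`W^{2,3}` is an algebra. In `D²(uv) = D²u v + 2 Du Dv + u D²v` the outer terms are bounded in `L³`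
by `L^∞ · L³` and the middle one by `L⁶ · L⁶`. This is exactly the shape of the asserted estimate,
and since only Hölder's inequality enters here, its constant does not depend on `Ω`.

Two ingredients are needed. The first is the product rule for weak derivatives (`IsWeakDeriv.mul`).
It is proved by doubling variables: the tested identity is embedded in a continuous function `J` of
a translation parameter. Averages of `J` against bumps near `0` vanish by the definition of the weak
derivatives, hence `J 0 = 0`.

The second is the pair of embeddings `W^{1,3} ⊆ L⁶` and `W^{1,6} ⊆ L^∞`, applied to `Du` and then to
`u` (`MemW.exists_hasJet`). Each point `x` of the domain is reached by a chain of interior balls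
with radii of order `l ^ k` (`exists_chain`). The smooth average of `u` is transported from one ball
to the next; its change is bounded by `l ^ (-2k)` times the integral of `|Du|` over a ball about `x`
of radius of order `l ^ k`. Lebesgue differentiation and telescoping bound `|u x|` by a discrete
Riesz potential of `|Du|` (`exists_potential_bound`). For `Du ∈ L⁶`, Hölder makes the series
geometric. For `Du ∈ L³`, Hölder alone gives no decay, and half of the local norm is used to gain
summability after integration in `x`. -/

lemma contDiff_partialDeriv {φ : E3 → ℝ} (h : ContDiff ℝ ((⊤ : ℕ∞) : WithTop ℕ∞) φ) (i : Fin 3) :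
    ContDiff ℝ ((⊤ : ℕ∞) : WithTop ℕ∞) (partialDeriv i φ) :=
  (h.fderiv_right (m := ((⊤ : ℕ∞) : WithTop ℕ∞)) (by simp)).clm_apply contDiff_const

lemma differentiable_of_smooth {φ : E3 → ℝ} (h : ContDiff ℝ ((⊤ : ℕ∞) : WithTop ℕ∞) φ) :
    Differentiable ℝ φ :=
  h.differentiable (by simp)

lemma partialDeriv_comm {φ : E3 → ℝ} (h : ContDiff ℝ ((⊤ : ℕ∞) : WithTop ℕ∞) φ) (i j : Fin 3) :
    partialDeriv i (partialDeriv j φ) = partialDeriv j (partialDeriv i φ) := by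
  have hd : Differentiable ℝ (fderiv ℝ φ) :=
    (h.fderiv_right (m := ((⊤ : ℕ∞) : WithTop ℕ∞)) (by simp)).differentiable (by simp)
  have key : ∀ (k l : Fin 3) (x : E3), partialDeriv k (partialDeriv l φ) x =
      fderiv ℝ (fderiv ℝ φ) x (EuclideanSpace.single k 1) (EuclideanSpace.single l 1) := by
    intro k l x
    have h1 : HasFDerivAt (partialDeriv l φ)
        ((fderiv ℝ (fderiv ℝ φ) x).flip (EuclideanSpace.single l 1)) x := by
      have := (hd x).hasFDerivAt.clm_apply (hasFDerivAt_const (EuclideanSpace.single l (1 : ℝ)) x)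
      rw [ContinuousLinearMap.comp_zero, zero_add] at this
      exact this
    have h2 := h1.fderiv
    rw [partialDeriv, h2]
    rfl
  funext x
  rw [key, key]
  exact second_derivative_symmetric (fun y => (differentiable_of_smooth h y).hasFDerivAt)
    (hd x).hasFDerivAt _ _

lemma tsupport_partialDeriv_subset (φ : E3 → ℝ) (i : Fin 3) :
    tsupport (partialDeriv i φ) ⊆ tsupport φ := by
  refine (closure_mono ?_).trans (tsupport_fderiv_subset ℝ (f := φ))
  intro x hx hx'
  exact hx (by simp [partialDeriv, hx'])

lemma partialDeriv_mul {φ ψ : E3 → ℝ} {x : E3} (hφ : DifferentiableAt ℝ φ x)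
    (hψ : DifferentiableAt ℝ ψ x) (i : Fin 3) :
    partialDeriv i (fun y => φ y * ψ y) x =
      partialDeriv i φ x * ψ x + φ x * partialDeriv i ψ x := by
  simp only [partialDeriv]
  rw [fderiv_fun_mul hφ hψ]
  simp [mul_comm]
  ring

lemma partialDeriv_comp_sub_right {ρ : E3 → ℝ} (i : Fin 3) (x z : E3) :
    partialDeriv i (fun y => ρ (y - z)) x = partialDeriv i ρ (x - z) := by
  simp only [partialDeriv]
  rw [fderiv_comp_sub]

lemma partialDeriv_comp_sub_left {ρ : E3 → ℝ} (hρ : Differentiable ℝ ρ) (i : Fin 3) (x z : E3) :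
    partialDeriv i (fun y => ρ (x - y)) z = -partialDeriv i ρ (x - z) := by
  have h : HasFDerivAt (fun y => ρ (x - y)) ((fderiv ℝ ρ (x - z)).comp
      (-ContinuousLinearMap.id ℝ E3)) z :=
    (hρ (x - z)).hasFDerivAt.comp z ((hasFDerivAt_id z).const_sub x)
  simp only [partialDeriv]
  rw [h.fderiv]
  simp

namespace IsTestFunction

variable {Ω : Set E3} {φ : E3 → ℝ}

lemma partialDeriv (h : IsTestFunction Ω φ) (i : Fin 3) :
    IsTestFunction Ω (partialDeriv i φ) :=
  ⟨contDiff_partialDeriv h.1 i,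
    h.2.1.mono' (subset_closure.trans (tsupport_partialDeriv_subset φ i)),
    (tsupport_partialDeriv_subset φ i).trans h.2.2⟩

lemma exists_bound (h : IsTestFunction Ω φ) : ∃ C, ∀ x, ‖φ x‖ ≤ C :=
  h.1.continuous.bounded_above_of_compact_support h.2.1

lemma mul_left (h : IsTestFunction Ω φ) {ψ : E3 → ℝ}
    (hψ : ContDiff ℝ ((⊤ : ℕ∞) : WithTop ℕ∞) ψ) : IsTestFunction Ω (fun x => φ x * ψ x) :=
  ⟨h.1.mul hψ, h.2.1.mul_right, (tsupport_mul_subset_left).trans h.2.2⟩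

end IsTestFunction

/-! ### Multi-indices of order at most two -/

lemma multiDeriv_zero (φ : E3 → ℝ) : multiDeriv 0 φ = φ := by
  simp [multiDeriv]

lemma multiDeriv_single (i : Fin 3) (φ : E3 → ℝ) :
    multiDeriv (Pi.single i 1) φ = partialDeriv i φ := by
  fin_cases i <;> simp [multiDeriv]

/-- `multiDeriv` differentiates in a fixed order of the coordinates, so symmetry of second
derivatives is what allows `i` and `j` to be in any order. -/
lemma multiDeriv_single_add_single (i j : Fin 3) {φ : E3 → ℝ}
    (h : ContDiff ℝ ((⊤ : ℕ∞) : WithTop ℕ∞) φ) :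
    multiDeriv (Pi.single i 1 + Pi.single j 1) φ = partialDeriv i (partialDeriv j φ) := by
  fin_cases i <;> fin_cases j <;> simp [multiDeriv] <;>
    exact partialDeriv_comm h _ _

lemma sum_single (i : Fin 3) : ∑ k, (Pi.single i 1 : Fin 3 → ℕ) k = 1 := by
  simp

lemma sum_single_add_single (i j : Fin 3) :
    ∑ k, (Pi.single i 1 + Pi.single j 1 : Fin 3 → ℕ) k = 2 := by
  simp [Finset.sum_add_distrib]

lemma exists_eq_single_add {γ : Fin 3 → ℕ} {n : ℕ} (h : ∑ k, γ k = n + 1) :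
    ∃ (i : Fin 3) (γ' : Fin 3 → ℕ), γ = Pi.single i 1 + γ' ∧ ∑ k, γ' k = n := by
  obtain ⟨i, hi⟩ : ∃ i, γ i ≠ 0 := by
    by_contra! hγ
    simp [hγ] at h
  have hle : (Pi.single i 1 : Fin 3 → ℕ) ≤ γ := by
    intro k
    by_cases hk : k = i
    · subst hk
      simpa using Nat.one_le_iff_ne_zero.2 hi
    · simp [hk]
  refine ⟨i, γ - Pi.single i 1, (add_tsub_cancel_of_le hle).symm, ?_⟩
  have h1 : ∑ k, γ k = ∑ k, (Pi.single i 1 : Fin 3 → ℕ) k + ∑ k, (γ - Pi.single i 1 : Fin 3 → ℕ) k := by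
    rw [← Finset.sum_add_distrib]
    exact Finset.sum_congr rfl fun k _ => congrFun (add_tsub_cancel_of_le hle).symm k
  rw [sum_single] at h1
  omega

lemma eq_zero_of_sum_eq_zero {γ : Fin 3 → ℕ} (h : ∑ k, γ k = 0) : γ = 0 := by
  funext k
  simpa using (Finset.sum_eq_zero_iff.1 h) k (Finset.mem_univ k)

lemma exists_eq_single {γ : Fin 3 → ℕ} (h : ∑ k, γ k = 1) : ∃ i, γ = Pi.single i 1 := by
  obtain ⟨i, γ', rfl, h'⟩ := exists_eq_single_add (n := 0) h
  exact ⟨i, by rw [eq_zero_of_sum_eq_zero h', add_zero]⟩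

lemma exists_eq_single_add_single {γ : Fin 3 → ℕ} (h : ∑ k, γ k = 2) :
    ∃ i j, γ = Pi.single i 1 + Pi.single j 1 := by
  obtain ⟨i, γ', rfl, h'⟩ := exists_eq_single_add (n := 1) h
  obtain ⟨j, rfl⟩ := exists_eq_single h'
  exact ⟨i, j, rfl⟩

/-! ### Weak derivatives -/

section WeakDeriv

variable {Ω : Set E3} {u v g h : E3 → ℝ} {γ : Fin 3 → ℕ}

lemma locallyIntegrableOn_congr_ae (hΩ : IsOpen Ω) (huv : u =ᵐ[volume.restrict Ω] v)
    (hu : LocallyIntegrableOn u Ω) : LocallyIntegrableOn v Ω := by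
  rw [locallyIntegrableOn_iff (hΩ.isLocallyClosed)] at hu ⊢
  intro K hK hKc
  exact (hu K hK hKc).congr (ae_restrict_of_ae_restrict_of_subset hK huv)

lemma MemLp.locallyIntegrableOn {p : ℝ≥0∞} (hp : 1 ≤ p) (hu : MemLp u p (volume.restrict Ω)) :
    LocallyIntegrableOn u Ω :=
  locallyIntegrableOn_of_locallyIntegrable_restrict (hu.locallyIntegrable hp)

lemma IsWeakDeriv.congr_ae (hΩ : IsOpen Ω) (H : IsWeakDeriv Ω γ u g)
    (huv : u =ᵐ[volume.restrict Ω] v) (hgh : g =ᵐ[volume.restrict Ω] h) :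
    IsWeakDeriv Ω γ v h := by
  refine ⟨locallyIntegrableOn_congr_ae hΩ huv H.1, locallyIntegrableOn_congr_ae hΩ hgh H.2.1,
    fun φ hφ => ?_⟩
  rw [← integral_congr_ae (huv.mono fun x hx => by simp only [hx] :
      (fun x => u x * multiDeriv γ φ x) =ᵐ[volume.restrict Ω] fun x => v x * multiDeriv γ φ x),
    ← integral_congr_ae (hgh.mono fun x hx => by simp only [hx] :
      (fun x => g x * φ x) =ᵐ[volume.restrict Ω] fun x => h x * φ x)]
  exact H.2.2 φ hφ

lemma IsWeakDeriv.ae_unique (hΩ : IsOpen Ω) (hg : IsWeakDeriv Ω γ u g)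
    (hh : IsWeakDeriv Ω γ u h) : g =ᵐ[volume.restrict Ω] h := by
  have hint : ∀ {f φ : E3 → ℝ}, LocallyIntegrableOn f Ω → IsTestFunction Ω φ →
      IntegrableOn (fun x => f x * φ x) Ω := by
    intro f φ hf hφ
    obtain ⟨C, hC⟩ := hφ.exists_bound
    have hK : IntegrableOn f (tsupport φ) :=
      (locallyIntegrableOn_iff (hΩ.isLocallyClosed)).1 hf _ hφ.2.2 hφ.2.1
    have h1 : IntegrableOn (fun x => f x * φ x) (tsupport φ) :=
      hK.mul_bdd hφ.1.continuous.aestronglyMeasurable (Filter.Eventually.of_forall hC)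
    have h2 : Integrable (fun x => f x * φ x) := by
      rw [← integrableOn_univ]
      refine h1.of_forall_sdiff_eq_zero MeasurableSet.univ fun x hx => ?_
      rw [image_eq_zero_of_notMem_tsupport hx.2, mul_zero]
    exact h2.integrableOn
  -- Fundamental lemma of the calculus of variations for `g - h`, whose integral against every test
  -- function vanishes.
  have key := hΩ.ae_eq_zero_of_integral_contDiff_smul_eq_zero (μ := volume)
    (hg.2.1.sub hh.2.1) (fun φ h1 h2 h3 => by
      have hφ : IsTestFunction Ω φ := ⟨h1, h2, h3⟩
      have e := (hg.2.2 φ hφ).symm.trans (hh.2.2 φ hφ)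
      have hne : ((-1 : ℝ)) ^ (∑ i, γ i) ≠ 0 := pow_ne_zero _ (by norm_num)
      have e' := mul_left_cancel₀ hne e
      rw [← setIntegral_eq_integral_of_forall_compl_eq_zero (s := Ω)]
      · have : ∀ x, φ x • (g - h) x = g x * φ x - h x * φ x := fun x => by
          simp only [smul_eq_mul, Pi.sub_apply]; ring
        simp_rw [this]
        rw [integral_sub (hint hg.2.1 hφ) (hint hh.2.1 hφ), e', sub_self]
      · intro x hx
        rw [image_eq_zero_of_notMem_tsupport (fun hx' => hx (h3 hx')), zero_smul])
  rw [Filter.EventuallyEq, ae_restrict_iff' hΩ.measurableSet]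
  filter_upwards [key] with x hx hxΩ
  exact sub_eq_zero.1 (hx hxΩ)

/-- The norms in the theorem are computed with a chosen representative; this exchanges it for
whichever weak derivative has been constructed. -/
lemma IsWeakDeriv.weakDeriv_ae_eq (hΩ : IsOpen Ω) (hg : IsWeakDeriv Ω γ u g) :
    weakDeriv Ω γ u =ᵐ[volume.restrict Ω] g := by
  have hex : ∃ g, IsWeakDeriv Ω γ u g := ⟨g, hg⟩
  rw [weakDeriv, dif_pos hex]
  exact hex.choose_spec.ae_unique hΩ hg

lemma isWeakDeriv_zero (hu : LocallyIntegrableOn u Ω) : IsWeakDeriv Ω 0 u u :=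
  ⟨hu, hu, fun φ _ => by simp [multiDeriv_zero]⟩

lemma isWeakDeriv_single_iff {i : Fin 3} : IsWeakDeriv Ω (Pi.single i 1) u g ↔
    LocallyIntegrableOn u Ω ∧ LocallyIntegrableOn g Ω ∧ ∀ φ, IsTestFunction Ω φ →
      ∫ x in Ω, u x * partialDeriv i φ x = -∫ x in Ω, g x * φ x := by
  simp only [IsWeakDeriv, multiDeriv_single, sum_single, pow_one, neg_mul, one_mul]

/-- Given the first derivative, second weak derivatives are iterated weak derivatives. -/
lemma isWeakDeriv_single_add_single_iff {i j : Fin 3} {G : E3 → ℝ}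
    (hg : IsWeakDeriv Ω (Pi.single i 1) u g) :
    IsWeakDeriv Ω (Pi.single i 1 + Pi.single j 1) u G ↔ IsWeakDeriv Ω (Pi.single j 1) g G := by
  have hg' := isWeakDeriv_single_iff.1 hg
  rw [isWeakDeriv_single_iff, IsWeakDeriv, sum_single_add_single]
  -- `∂ⱼφ` is itself a test function, so one integration by parts with `g` is available.
  have key : ∀ φ, IsTestFunction Ω φ →
      ∫ x in Ω, u x * multiDeriv (Pi.single i 1 + Pi.single j 1) φ x =
        -∫ x in Ω, g x * partialDeriv j φ x := by
    intro φ hφ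
    rw [multiDeriv_single_add_single i j hφ.1]
    exact hg'.2.2 _ (hφ.partialDeriv j)
  refine ⟨fun H => ⟨hg'.2.1, H.2.1, fun φ hφ => ?_⟩, fun H => ⟨hg'.1, H.2.1, fun φ hφ => ?_⟩⟩
  · have := H.2.2 φ hφ
    rw [key φ hφ] at this
    linarith
  · rw [key φ hφ, H.2.2 φ hφ]
    ring

end WeakDeriv

/-! ### The product rule for weak derivatives -/

/-- Translation acts continuously on `L²`, and the integral is the inner product of `P` with a
translate of `V`. -/
lemma continuous_integral_mul_comp_sub {P V : E3 → ℝ} (hP : MemLp P 2) (hV : MemLp V 2) :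
    Continuous fun y : E3 => ∫ x, P x * V (x - y) := by
  have : Fact ((2 : ℝ≥0∞) ≠ ∞) := ⟨by simp⟩
  have h1 : Continuous fun y : E3 => inner ℝ (DomAddAct.mk (-y) +ᵥ hV.toLp V) (hP.toLp P) := by
    refine Continuous.inner ?_ continuous_const
    exact (DomAddAct.continuous_mk.comp continuous_neg).vadd continuous_const
  convert h1 using 2 with y
  rw [DomAddAct.mk_vadd_toLp, L2.inner_def]
  refine integral_congr_ae ?_
  filter_upwards [hP.coeFn_toLp, (hV.comp_measurePreserving
    (measurePreserving_vadd (-y) (volume : Measure E3))).coeFn_toLp] with x hx hx'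
  simp only [Function.comp_def] at hx'
  rw [hx, hx']
  simp [sub_eq_neg_add]

lemma integrable_prod_mul_kernel {a b : E3 → ℝ} (ha : Integrable a) (hb : Integrable b)
    {k : E3 → E3 → ℝ} (hk : Continuous (Function.uncurry k)) {C : ℝ} (hC : ∀ x z, ‖k x z‖ ≤ C) :
    Integrable (fun p : E3 × E3 => a p.1 * b p.2 * k p.1 p.2) (volume.prod volume) :=
  (ha.mul_prod hb).mul_bdd (c := C) hk.aestronglyMeasurable
    (Filter.Eventually.of_forall fun p => hC p.1 p.2)

/-- Averaging the translated pairing against a kernel. -/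
lemma integral_mul_integral_comp_sub {P V ρ : E3 → ℝ} (hP : Integrable P) (hV : Integrable V)
    (hρ : Continuous ρ) {C : ℝ} (hC : ∀ x, ‖ρ x‖ ≤ C) :
    ∫ y, ρ y * ∫ x, P x * V (x - y) = ∫ x, ∫ z, P x * V z * ρ (x - z) := by
  have h0 : Integrable (fun p : E3 × E3 => P p.2 * V (p.2 - p.1) * ρ p.1)
      (volume.prod volume) := by
    have h1 := hP.convolution_integrand (ContinuousLinearMap.mul ℝ ℝ) hV.comp_neg
      (μ := volume) (ν := volume)
    refine (Integrable.mul_bdd (c := C) h1 (hρ.comp continuous_fst).aestronglyMeasurable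
      (Filter.Eventually.of_forall fun p => hC p.1)).congr
      (Filter.Eventually.of_forall fun p => ?_)
    simp
  calc ∫ y, ρ y * ∫ x, P x * V (x - y)
      = ∫ y, ∫ x, P x * V (x - y) * ρ y := by
        refine integral_congr_ae (Filter.Eventually.of_forall fun y => ?_)
        simp only
        rw [← integral_const_mul]
        exact integral_congr_ae (Filter.Eventually.of_forall fun x => mul_comm _ _)
    _ = ∫ x, ∫ y, P x * V (x - y) * ρ y := integral_integral_swap h0
    _ = ∫ x, ∫ z, P x * V z * ρ (x - z) := by
        refine integral_congr_ae (Filter.Eventually.of_forall fun x => ?_)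
        simp only
        rw [← integral_sub_left_eq_self _ volume x]
        simp

lemma integral_indicator_mul {Ω : Set E3} (hΩ : IsOpen Ω) (u φ : E3 → ℝ) :
    ∫ x, Ω.indicator u x * φ x = ∫ x in Ω, u x * φ x := by
  rw [← integral_indicator hΩ.measurableSet]
  refine integral_congr_ae (Filter.Eventually.of_forall fun x => ?_)
  by_cases hx : x ∈ Ω <;> simp [hx]

/-- Product rule for functions that are square integrable together with their weak derivatives. -/
theorem IsWeakDeriv.mul {Ω : Set E3} (hΩ : IsOpen Ω) (hfin : volume Ω ≠ ∞) {i : Fin 3}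
    {u v g h : E3 → ℝ} (hu : MemLp u 2 (volume.restrict Ω)) (hv : MemLp v 2 (volume.restrict Ω))
    (hg : MemLp g 2 (volume.restrict Ω)) (hh : MemLp h 2 (volume.restrict Ω))
    (hug : IsWeakDeriv Ω (Pi.single i 1) u g) (hvh : IsWeakDeriv Ω (Pi.single i 1) v h) :
    IsWeakDeriv Ω (Pi.single i 1) (fun x => u x * v x) (fun x => g x * v x + u x * h x) := by
  have hfm : IsFiniteMeasure (volume.restrict Ω) := ⟨by simpa using hfin.lt_top⟩
  have huv : Integrable (fun x => u x * v x) (volume.restrict Ω) := hu.integrable_mul hv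
  have hgv : Integrable (fun x => g x * v x) (volume.restrict Ω) := hg.integrable_mul hv
  have huh : Integrable (fun x => u x * h x) (volume.restrict Ω) := hu.integrable_mul hh
  refine isWeakDeriv_single_iff.2
    ⟨MemLp.locallyIntegrableOn le_rfl (memLp_one_iff_integrable.2 huv),
      MemLp.locallyIntegrableOn le_rfl (memLp_one_iff_integrable.2 (hgv.add huh)),
      fun φ hφ => ?_⟩
  have hug' := (isWeakDeriv_single_iff.1 hug).2.2
  have hvh' := (isWeakDeriv_single_iff.1 hvh).2.2
  have ext2 : ∀ {f : E3 → ℝ}, MemLp f 2 (volume.restrict Ω) → MemLp (Ω.indicator f) 2 :=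
    fun hf => (memLp_indicator_iff_restrict hΩ.measurableSet).2 hf
  have ext1 : ∀ {f : E3 → ℝ}, MemLp f 2 (volume.restrict Ω) → Integrable (Ω.indicator f) :=
    fun hf => (integrable_indicator_iff hΩ.measurableSet).2 (hf.integrable (by norm_num))
  obtain ⟨Cφ, hCφ⟩ := hφ.exists_bound
  obtain ⟨Cd, hCd⟩ := (hφ.partialDeriv i).exists_bound
  have cφ := hφ.1.continuous
  have cd := (hφ.partialDeriv i).1.continuous
  set U := Ω.indicator u with hU
  set V := Ω.indicator v with hV
  set G := Ω.indicator g with hG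
  set H := Ω.indicator h with hH
  set P : E3 → ℝ := fun x => U x * partialDeriv i φ x + G x * φ x with hPdef
  set Q : E3 → ℝ := fun x => U x * φ x with hQdef
  have mulB2 : ∀ {f ψ : E3 → ℝ} {C : ℝ}, MemLp f 2 → Continuous ψ → (∀ x, ‖ψ x‖ ≤ C) →
      MemLp (fun x => f x * ψ x) 2 := by
    intro f ψ C hf hψ hC
    have h1 : MemLp ψ ∞ volume :=
      memLp_top_of_bound hψ.aestronglyMeasurable C (Filter.Eventually.of_forall hC)
    exact hf.mul' (q := 2) (p := ∞) h1 |>.congr_norm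
      ((hf.1.mul h1.1)) (Filter.Eventually.of_forall fun x => by simp [mul_comm])
  have hP2 : MemLp P 2 := (mulB2 (ext2 hu) cd hCd).add (mulB2 (ext2 hg) cφ hCφ)
  have hQ2 : MemLp Q 2 := mulB2 (ext2 hu) cφ hCφ
  have hQ1 : Integrable Q :=
    (ext1 hu).mul_bdd cφ.aestronglyMeasurable (Filter.Eventually.of_forall hCφ)
  have hP1 : Integrable P :=
    ((ext1 hu).mul_bdd cd.aestronglyMeasurable (Filter.Eventually.of_forall hCd)).add
    ((ext1 hg).mul_bdd cφ.aestronglyMeasurable (Filter.Eventually.of_forall hCφ))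
  -- `J 0` is the integral of `u v ∂ᵢφ + (g v + u h) φ` over `Ω`, whose vanishing is the product
  -- rule. For `y ≠ 0` the functions `u` and `v` are evaluated at different points, which separates
  -- the two integrations by parts.
  set J : E3 → ℝ := fun y => (∫ x, P x * V (x - y)) + ∫ x, Q x * H (x - y) with hJ
  have cJ1 := continuous_integral_mul_comp_sub hP2 (ext2 hv)
  have cJ2 := continuous_integral_mul_comp_sub hQ2 (ext2 hh)
  have cJ : Continuous J := cJ1.add cJ2
  -- For `x ∈ tsupport φ` and `ρ` supported in the `δ`-ball, `z ↦ ρ (x - z)` is then a test function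
  -- in `Ω`.
  obtain ⟨δ, hδ, hδΩ⟩ := hφ.2.1.isCompact.exists_cthickening_subset_open hΩ hφ.2.2
  have hJ0 : J 0 = 0 := by
    have hae := (Metric.isOpen_ball (x := (0 : E3)) (ε := δ)).ae_eq_zero_of_integral_contDiff_smul_eq_zero
      (μ := volume) (cJ.locallyIntegrable.locallyIntegrableOn _) (fun ρ h1 h2 h3 => by
        have hρ : IsTestFunction (Metric.ball 0 δ) ρ := ⟨h1, h2, h3⟩
        obtain ⟨Cρ, hCρ⟩ := hρ.exists_bound
        obtain ⟨Cρ', hCρ'⟩ := (hρ.partialDeriv i).exists_bound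
        have cρ := h1.continuous
        have cρ' := (hρ.partialDeriv i).1.continuous
        have i1 : Integrable fun y => ρ y * ∫ x, P x * V (x - y) :=
          (cρ.mul cJ1).integrable_of_hasCompactSupport h2.mul_right
        have i2 : Integrable fun y => ρ y * ∫ x, Q x * H (x - y) :=
          (cρ.mul cJ2).integrable_of_hasCompactSupport h2.mul_right
        have csub : Continuous fun p : E3 × E3 => p.1 - p.2 := continuous_fst.sub continuous_snd
        have iA := integrable_prod_mul_kernel hP1 (ext1 hv)
          (k := fun x z => ρ (x - z)) (cρ.comp csub) (fun x z => hCρ _)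
        have iD := integrable_prod_mul_kernel hQ1 (ext1 hv)
          (k := fun x z => partialDeriv i ρ (x - z)) (cρ'.comp csub) (fun x z => hCρ' _)
        have e : ∀ y, ρ y • J y = ρ y * (∫ x, P x * V (x - y)) + ρ y * ∫ x, Q x * H (x - y) :=
          fun y => mul_add _ _ _
        simp_rw [e]
        rw [integral_add i1 i2, integral_mul_integral_comp_sub hP1 (ext1 hv) cρ hCρ,
          integral_mul_integral_comp_sub hQ1 (ext1 hh) cρ hCρ]
        -- the derivative of `ρ` is moved onto `h`
        have hB : ∫ x, ∫ z, Q x * H z * ρ (x - z) =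
            ∫ x, ∫ z, Q x * V z * partialDeriv i ρ (x - z) := by
          refine integral_congr_ae (Filter.Eventually.of_forall fun x => ?_)
          simp only [mul_assoc]
          rw [integral_const_mul, integral_const_mul]
          by_cases hx : x ∈ tsupport φ
          · congr 1
            have ht : IsTestFunction Ω (fun z => ρ (x - z)) := by
              refine ⟨h1.comp (contDiff_const.sub contDiff_id),
                h2.comp_homeomorph (Homeomorph.subLeft x), ?_⟩
              intro z hz
              have hz' : x - z ∈ tsupport ρ :=
                tsupport_comp_subset_preimage ρ (continuous_const.sub continuous_id) hz
              apply hδΩ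
              refine Metric.mem_cthickening_of_dist_le z x δ _ hx ?_
              have := h3 hz'
              rw [mem_ball_zero_iff] at this
              rw [dist_comm, dist_eq_norm]
              exact this.le
            have := hvh' _ ht
            rw [integral_indicator_mul hΩ, integral_indicator_mul hΩ]
            rw [← neg_eq_iff_eq_neg] at this
            rw [← this, ← integral_neg]
            refine integral_congr_ae (Filter.Eventually.of_forall fun z => ?_)
            simp only
            rw [partialDeriv_comp_sub_left (differentiable_of_smooth h1)]
            ring
          · rw [hQdef]
            simp [image_eq_zero_of_notMem_tsupport hx]
        rw [hB]
        refine (integral_integral_add' iA iD).symm.trans ?_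
        refine (integral_integral_swap (iA.add iD)).trans ?_
        refine integral_eq_zero_of_ae (Filter.Eventually.of_forall fun z => ?_)
        simp only [Pi.add_apply, Pi.zero_apply]
        -- the integral against the test function `x ↦ φ x * ρ (x - z)`
        have ht : IsTestFunction Ω (fun x => φ x * ρ (x - z)) :=
          hφ.mul_left (h1.comp (contDiff_id.sub contDiff_const))
        have := hug' _ ht
        have iu : Integrable (fun x => U x * partialDeriv i (fun x => φ x * ρ (x - z)) x) := by
          obtain ⟨C, hC⟩ := (ht.partialDeriv i).exists_bound
          exact (ext1 hu).mul_bdd (ht.partialDeriv i).1.continuous.aestronglyMeasurable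
            (Filter.Eventually.of_forall hC)
        have ig : Integrable (fun x => G x * (φ x * ρ (x - z))) := by
          obtain ⟨C, hC⟩ := ht.exists_bound
          exact (ext1 hg).mul_bdd ht.1.continuous.aestronglyMeasurable
            (Filter.Eventually.of_forall hC)
        rw [← integral_indicator_mul hΩ, ← integral_indicator_mul hΩ] at this
        have h4 : ∫ x, V z * (U x * partialDeriv i (fun x => φ x * ρ (x - z)) x +
            G x * (φ x * ρ (x - z))) = 0 := by
          rw [integral_const_mul, integral_add iu ig, this, neg_add_cancel, mul_zero]
        rw [← h4]
        refine integral_congr_ae (Filter.Eventually.of_forall fun x => ?_)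
        simp only [hPdef, hQdef]
        have hd : DifferentiableAt ℝ (fun x => ρ (x - z)) x :=
          differentiable_of_smooth (h1.comp (contDiff_id.sub contDiff_const)) x
        rw [partialDeriv_mul (differentiable_of_smooth hφ.1 x) hd,
          partialDeriv_comp_sub_right]
        ring)
    -- `J` is continuous, so vanishing almost everywhere near `0` gives its value at `0`.
    have hJae : J =ᵐ[volume.restrict (Metric.ball 0 δ)] fun _ => 0 := by
      rw [Filter.EventuallyEq, ae_restrict_iff' Metric.isOpen_ball.measurableSet]
      exact hae
    exact Measure.eqOn_open_of_ae_eq hJae Metric.isOpen_ball cJ.continuousOn continuousOn_const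
      (Metric.mem_ball_self hδ)
  have key : ∀ x, P x * V (x - 0) + Q x * H (x - 0) =
      Ω.indicator (fun x => u x * v x) x * partialDeriv i φ x +
      Ω.indicator (fun x => g x * v x + u x * h x) x * φ x := by
    intro x
    by_cases hx : x ∈ Ω
    · simp only [hPdef, hQdef, hU, hV, hG, hH, sub_zero, indicator_of_mem hx]
      ring
    · simp [hPdef, hQdef, hU, hV, hG, hH, hx]
  rw [hJ] at hJ0
  simp only at hJ0
  rw [← integral_add] at hJ0
  · simp_rw [key] at hJ0
    rw [integral_add, integral_indicator_mul hΩ, integral_indicator_mul hΩ] at hJ0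
    · linarith
    · exact ((integrable_indicator_iff hΩ.measurableSet).2 huv).mul_bdd cd.aestronglyMeasurable
        (Filter.Eventually.of_forall hCd)
    · exact ((integrable_indicator_iff hΩ.measurableSet).2 (hgv.add huh)).mul_bdd
        cφ.aestronglyMeasurable (Filter.Eventually.of_forall hCφ)
  · simp only [sub_zero]
    exact hP2.integrable_mul (ext2 hv)
  · simp only [sub_zero]
    exact hQ2.integrable_mul (ext2 hh)

/-! ### Chains of balls in domains with Lipschitz boundary -/

/-- A ball that avoids the frontier meets `Ω` in a relatively clopen set, and balls are connected.
The centre is only assumed to lie in the closure because points of the chain are known only as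
images under a chart. -/
lemma closedBall_subset_of_frontier_far {Ω : Set E3} (hΩ : IsOpen Ω) {y : E3} {r : ℝ}
    (hr : 0 ≤ r) (hy : y ∈ closure Ω) (h : ∀ w ∈ frontier Ω, r < dist w y) :
    Metric.closedBall y r ⊆ Ω := by
  have key : ∀ w ∈ closure Ω, dist w y ≤ r → w ∈ Ω := by
    intro w hw hd
    by_contra hwΩ
    exact absurd (h w ⟨hw, by rwa [hΩ.interior_eq]⟩) (not_lt.2 hd)
  refine (convex_closedBall y r).isPreconnected.subset_of_closure_inter_subset hΩ
    ⟨y, Metric.mem_closedBall_self hr, key y hy (by simpa using hr)⟩ ?_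
  rintro w ⟨hw, hwb⟩
  exact key w hw hwb

lemma convex_halfBall : Convex ℝ halfBall := by
  have h1 : halfBall = Metric.closedBall (0 : E3) 1 ∩
      (EuclideanSpace.proj (𝕜 := ℝ) (2 : Fin 3)) ⁻¹' Ici (0 : ℝ) := by
    ext y
    simp [halfBall]
  rw [h1]
  exact (convex_closedBall _ _).inter
    ((convex_Ici (0 : ℝ)).linear_preimage (EuclideanSpace.proj (𝕜 := ℝ) (2 : Fin 3)).toLinearMap)

/-- In a bounded domain with Lipschitz boundary, every point is the limit of a chain of balls with
geometrically decreasing radii, comparable to the distance from the point. -/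
theorem exists_chain {Ω : Set E3} (hΩ : IsOpen Ω) (hb : Bornology.IsBounded Ω)
    (hL : HasLipschitzBoundary Ω) :
    ∃ μ c C : ℝ, 0 < μ ∧ μ < 1 ∧ 0 < c ∧ 0 < C ∧ ∀ x ∈ Ω, ∃ y : ℕ → E3, ∀ k,
      dist (y k) x ≤ C * (μ ^ 4) ^ k ∧ Metric.closedBall (y k) (c * (μ ^ 4) ^ k) ⊆ Ω ∧
      dist (y (k + 1)) (y k) ≤ c / 4 * (μ ^ 4) ^ k := by
  obtain ⟨M, U, Φ, K₀, hU, hcov, hΦ⟩ := hL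
  have hcomp : IsCompact (frontier Ω) :=
    Metric.isCompact_of_isClosed_isBounded isClosed_frontier
      (hb.closure.subset frontier_subset_closure)
  obtain ⟨δ, hδ, hleb⟩ := lebesgue_number_lemma_of_metric hcomp hU hcov
  set K : ℝ := max K₀ 1 with hK
  have hK0 : 0 < K := lt_of_lt_of_le one_pos (le_max_right _ _)
  have hlip : ∀ m, ∀ y ∈ halfBall, ∀ z ∈ halfBall,
      dist (Φ m y) (Φ m z) ≤ K * dist y z ∧ dist y z ≤ K * dist (Φ m y) (Φ m z) := by
    intro m y hy z hz
    obtain ⟨h1, h2⟩ := (hΦ m).1 y hy z hz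
    exact ⟨h1.trans (mul_le_mul_of_nonneg_right (le_max_left _ _) dist_nonneg),
      h2.trans (mul_le_mul_of_nonneg_right (le_max_left _ _) dist_nonneg)⟩
  -- Three constants: `τ` is the initial displacement in the chart, small enough to keep the chain
  -- within `δ / 4` of `x`; `d` is the guaranteed clearance from the frontier at scale `1`; `ε`
  -- makes the ratio `l = (1 - ε) ^ 4` so close to `1` that consecutive centres differ by at most a
  -- quarter of the radius.
  set τ : ℝ := min 1 (δ / (8 * K)) with hτ
  have hτ0 : 0 < τ := lt_min one_pos (by positivity)
  have hτ1 : τ ≤ 1 := min_le_left _ _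
  have hτδ : 2 * K * τ ≤ δ / 4 := by
    have : τ ≤ δ / (8 * K) := min_le_right _ _
    rw [le_div_iff₀ (by positivity)] at this
    linarith
  set d : ℝ := min (δ / 4) (τ / (2 * K)) with hd
  have hd0 : 0 < d := lt_min (by positivity) (by positivity)
  set ε : ℝ := min (1 / 2) (d / (64 * K * τ)) with hε
  have hε0 : 0 < ε := lt_min (by norm_num) (by positivity)
  have hε1 : ε ≤ 1 / 2 := min_le_left _ _
  have hεd : 64 * K * τ * ε ≤ d := by
    have : ε ≤ d / (64 * K * τ) := min_le_right _ _
    rw [le_div_iff₀ (by positivity)] at this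
    linarith
  set l : ℝ := (1 - ε) ^ 4 with hl
  have hl0 : 0 < l := pow_pos (by linarith) 4
  have hl1 : l ≤ 1 := pow_le_one₀ (by linarith) (by linarith)
  have hl2 : 1 - l ≤ 4 * ε := by
    have := one_add_mul_le_pow (a := -ε) (by linarith) 4
    rw [hl, sub_eq_add_neg 1 ε]
    push_cast at this
    linarith
  have hlk : ∀ k, 0 < l ^ k ∧ l ^ k ≤ 1 := fun k => ⟨pow_pos hl0 k, pow_le_one₀ hl0.le hl1⟩
  refine ⟨1 - ε, d / 2, 2 * K * τ, by linarith, by linarith, by positivity, by positivity,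
    fun x hx => ?_⟩
  by_cases hfar : ∀ z ∈ frontier Ω, δ / 4 ≤ dist x z
  · refine ⟨fun _ => x, fun k => ⟨?_, ?_, ?_⟩⟩
    · rw [dist_self]
      exact mul_nonneg (by positivity) (hlk k).1.le
    · refine closedBall_subset_of_frontier_far hΩ (mul_nonneg (by positivity) (hlk k).1.le)
        (subset_closure hx) fun w hw => ?_
      have h1 := hfar w hw
      rw [dist_comm] at h1
      have h2 : d ≤ δ / 4 := min_le_left _ _
      have h3 : d / 2 * l ^ k ≤ d / 2 := mul_le_of_le_one_right (by positivity) (hlk k).2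
      linarith
    · rw [dist_self]
      exact mul_nonneg (by positivity) (hlk k).1.le
  push Not at hfar
  obtain ⟨z, hz, hxz⟩ := hfar
  obtain ⟨m, hm⟩ := hleb z hz
  have hxU : x ∈ closure (U m) ∩ closure Ω :=
    ⟨subset_closure (hm (by rw [Metric.mem_ball]; linarith)), subset_closure hx⟩
  rw [← (hΦ m).2.1] at hxU
  obtain ⟨p, hp, rfl⟩ := hxU
  set q : E3 := EuclideanSpace.single 2 (1 / 2) with hq
  have hqn : ‖q‖ = 1 / 2 := by simp [hq]
  have hqh : q ∈ halfBall := ⟨by rw [hqn]; norm_num, by simp [hq]⟩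
  have hpq : ‖q - p‖ ≤ 2 := (norm_sub_le q p).trans (by rw [hqn]; linarith [hp.1])
  -- In the chart the chain lies on the segment from `p` to the interior point `q`. Its height above
  -- the flat face is at least `τ * l ^ k / 2`, comparable to its distance from `p`, and the
  -- bi-Lipschitz chart preserves this up to `K`.
  set η : ℕ → E3 := fun k => p + (τ * l ^ k) • (q - p) with hη
  have htk : ∀ k, 0 < τ * l ^ k ∧ τ * l ^ k ≤ 1 := fun k =>
    ⟨mul_pos hτ0 (hlk k).1, mul_le_one₀ hτ1 (hlk k).1.le (hlk k).2⟩
  have hηh : ∀ k, η k ∈ halfBall := fun k =>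
    convex_halfBall.add_smul_sub_mem hp hqh ⟨(htk k).1.le, (htk k).2⟩
  have hη2 : ∀ k, τ * l ^ k / 2 ≤ (η k) 2 := by
    intro k
    have h1 : (η k) 2 = (1 - τ * l ^ k) * p 2 + τ * l ^ k / 2 := by
      simp [hη, hq]
      ring
    rw [h1]
    have := mul_nonneg (sub_nonneg.2 (htk k).2) hp.2
    linarith
  have hηp : ∀ k, dist (η k) p ≤ 2 * (τ * l ^ k) := by
    intro k
    rw [dist_eq_norm, hη]
    simp only [add_sub_cancel_left]
    rw [norm_smul, Real.norm_of_nonneg (htk k).1.le, mul_comm]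
    exact mul_le_mul_of_nonneg_right hpq (htk k).1.le
  have hyx : ∀ k, dist (Φ m (η k)) (Φ m p) ≤ 2 * K * τ * l ^ k := fun k =>
    (hlip m _ (hηh k) _ hp).1.trans
      ((mul_le_mul_of_nonneg_left (hηp k) hK0.le).trans_eq (by ring))
  refine ⟨fun k => Φ m (η k), fun k => ⟨hyx k, ?_, ?_⟩⟩
  · have hcl : Φ m (η k) ∈ closure (U m) ∩ closure Ω := by
      rw [← (hΦ m).2.1]
      exact mem_image_of_mem _ (hηh k)
    refine closedBall_subset_of_frontier_far hΩ (mul_nonneg (by positivity) (hlk k).1.le)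
      hcl.2 fun w hw => ?_
    have h0 : d / 2 * l ^ k < d * l ^ k :=
      mul_lt_mul_of_pos_right (by linarith) (hlk k).1
    refine h0.trans_le ?_
    -- A frontier point closer than `δ / 4` lies within `δ` of `z`, hence in the same chart, where
    -- it comes from the flat face.
    by_cases hwd : δ / 4 ≤ dist w (Φ m (η k))
    · have h2 : d ≤ δ / 4 := min_le_left _ _
      have h3 : d * l ^ k ≤ d := mul_le_of_le_one_right hd0.le (hlk k).2
      linarith
    · push Not at hwd
      have hyx' : dist (Φ m (η k)) (Φ m p) ≤ δ / 4 :=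
        (hyx k).trans ((mul_le_of_le_one_right (by positivity) (hlk k).2).trans hτδ)
      have hwU : w ∈ closure (U m) ∩ frontier Ω := by
        refine ⟨subset_closure (hm ?_), hw⟩
        rw [Metric.mem_ball]
        have t1 := dist_triangle w (Φ m (η k)) z
        have t2 := dist_triangle (Φ m (η k)) (Φ m p) z
        linarith
      rw [← (hΦ m).2.2] at hwU
      obtain ⟨f, hf, rfl⟩ := hwU
      have h1 := (hlip m f ⟨hf.1, hf.2.ge⟩ _ (hηh k)).2
      have h2 : τ * l ^ k / 2 ≤ dist f (η k) := by
        have h3 : |(f - η k) 2| ≤ ‖f - η k‖ := by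
          simpa using PiLp.norm_apply_le (f - η k) 2
        rw [dist_eq_norm]
        have h4 : (f - η k) 2 = -(η k) 2 := by simp [hf.2]
        rw [h4, abs_neg] at h3
        exact (hη2 k).trans ((le_abs_self _).trans h3)
      have h5 : d ≤ τ / (2 * K) := min_le_right _ _
      have h6 : d * l ^ k ≤ τ / (2 * K) * l ^ k := mul_le_mul_of_nonneg_right h5 (hlk k).1.le
      refine h6.trans ?_
      have h7 : τ / (2 * K) * l ^ k = τ * l ^ k / 2 / K := by
        field_simp
      rw [h7, div_le_iff₀ hK0]
      linarith
  · refine (hlip m _ (hηh (k + 1)) _ (hηh k)).1.trans ?_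
    have h1 : dist (η (k + 1)) (η k) ≤ τ * l ^ k * (1 - l) * 2 := by
      have h2 : η (k + 1) - η k = (-(τ * l ^ k * (1 - l))) • (q - p) := by
        simp only [hη]
        rw [add_sub_add_left_eq_sub, ← sub_smul]
        congr 1
        ring
      rw [dist_eq_norm, h2, norm_smul, norm_neg,
        Real.norm_of_nonneg (mul_nonneg (htk k).1.le (by linarith))]
      exact mul_le_mul_of_nonneg_left hpq (mul_nonneg (htk k).1.le (by linarith))
    have h3 : K * dist (η (k + 1)) (η k) ≤ K * (τ * l ^ k * (4 * ε) * 2) := by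
      refine mul_le_mul_of_nonneg_left (h1.trans ?_) hK0.le
      refine mul_le_mul_of_nonneg_right ?_ (by norm_num)
      exact mul_le_mul_of_nonneg_left hl2 (htk k).1.le
    refine h3.trans ?_
    have h4 := mul_le_mul_of_nonneg_right hεd (hlk k).1.le
    linarith

/-! ### Averages against moving bump functions -/

/-- A smooth probability density supported in the closed unit ball. -/
structure IsUnitBump (b : E3 → ℝ) (M : ℝ) : Prop where
  smooth : ContDiff ℝ ((⊤ : ℕ∞) : WithTop ℕ∞) b
  nonneg : ∀ x, 0 ≤ b x
  le : ∀ x, b x ≤ M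
  integral_eq : ∫ x, b x = 1
  eq_zero : ∀ x, 1 < ‖x‖ → b x = 0

lemma exists_isUnitBump : ∃ (b : E3 → ℝ) (M : ℝ), IsUnitBump b M := by
  let f : ContDiffBump (0 : E3) := ⟨1 / 2, 1, by norm_num, by norm_num⟩
  obtain ⟨M, hM⟩ := f.continuous_normed.bounded_above_of_compact_support
    (f.hasCompactSupport_normed (μ := volume))
  refine ⟨f.normed volume, M, f.contDiff_normed, fun x => f.nonneg_normed x,
    fun x => (le_abs_self _).trans (hM x), f.integral_normed, fun x hx => ?_⟩
  by_contra hne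
  have : x ∈ Function.support (f.normed volume) := hne
  rw [f.support_normed_eq, mem_ball_zero_iff] at this
  exact absurd this (not_lt.2 hx.le)

/-- The density `b` rescaled to the ball with centre `y` and radius `r`. -/
noncomputable def scaledBump (b : E3 → ℝ) (y : E3) (r : ℝ) (z : E3) : ℝ :=
  (r⁻¹) ^ 3 * b (r⁻¹ • (z - y))

namespace IsUnitBump

variable {b : E3 → ℝ} {M : ℝ}

lemma bound_nonneg (hb : IsUnitBump b M) : 0 ≤ M := (hb.nonneg 0).trans (hb.le 0)

lemma scaled_smooth (hb : IsUnitBump b M) (y : E3) (r : ℝ) :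
    ContDiff ℝ ((⊤ : ℕ∞) : WithTop ℕ∞) (scaledBump b y r) :=
  contDiff_const.mul (hb.smooth.comp ((contDiff_id.sub contDiff_const).const_smul r⁻¹))

lemma scaled_nonneg (hb : IsUnitBump b M) (y : E3) {r : ℝ} (hr : 0 < r) (z : E3) :
    0 ≤ scaledBump b y r z :=
  mul_nonneg (by positivity) (hb.nonneg _)

lemma scaled_le (hb : IsUnitBump b M) (y : E3) {r : ℝ} (hr : 0 < r) (z : E3) :
    scaledBump b y r z ≤ (r⁻¹) ^ 3 * M :=
  mul_le_mul_of_nonneg_left (hb.le _) (by positivity)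

lemma scaled_eq_zero (hb : IsUnitBump b M) {y : E3} {r : ℝ} (hr : 0 < r) {z : E3}
    (hz : z ∉ Metric.closedBall y r) : scaledBump b y r z = 0 := by
  rw [scaledBump, hb.eq_zero, mul_zero]
  rw [norm_smul, Real.norm_of_nonneg (by positivity), inv_mul_eq_div, one_lt_div hr]
  simpa [dist_eq_norm] using hz

lemma tsupport_scaled_subset (hb : IsUnitBump b M) (y : E3) {r : ℝ} (hr : 0 < r) :
    tsupport (scaledBump b y r) ⊆ Metric.closedBall y r := by
  refine closure_minimal (fun z hz => ?_) Metric.isClosed_closedBall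
  by_contra h
  exact hz (hb.scaled_eq_zero hr h)

lemma isTestFunction_scaled (hb : IsUnitBump b M) {Ω : Set E3} {y : E3} {r : ℝ} (hr : 0 < r)
    (h : Metric.closedBall y r ⊆ Ω) : IsTestFunction Ω (scaledBump b y r) :=
  ⟨hb.scaled_smooth y r,
    (isCompact_closedBall y r).of_isClosed_subset (isClosed_tsupport _)
      (hb.tsupport_scaled_subset y hr),
    (hb.tsupport_scaled_subset y hr).trans h⟩

lemma integral_scaled (hb : IsUnitBump b M) (y : E3) {r : ℝ} (hr : 0 < r) :
    ∫ z, scaledBump b y r z = 1 := by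
  simp only [scaledBump]
  rw [integral_const_mul, integral_sub_right_eq_self (fun z => b (r⁻¹ • z)) y,
    Measure.integral_comp_smul, hb.integral_eq]
  have hd : Module.finrank ℝ E3 = 3 := by simp
  rw [hd, abs_of_nonneg (by positivity)]
  simp only [smul_eq_mul, mul_one]
  field_simp

/-- The transport equation for a moving bump, whose centre moves with constant velocity, and whose
radius changes exponentially. -/
lemma hasDerivAt_scaled (hb : IsUnitBump b M) (y v : E3) {r : ℝ} (hr : 0 < r) (a s : ℝ) (z : E3) :
    HasDerivAt (fun s : ℝ => scaledBump b (y + s • v) (r * Real.exp (a * s)) z)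
      (-∑ i, partialDeriv i (fun z => scaledBump b (y + s • v) (r * Real.exp (a * s)) z *
        (v + a • (z - (y + s • v))) i) z) s := by
  have hdb : Differentiable ℝ b := differentiable_of_smooth hb.smooth
  set ρ : ℝ := (r * Real.exp (a * s))⁻¹ with hρ
  set w : E3 := ρ • (z - (y + s • v)) with hw
  have hq : HasDerivAt (fun s : ℝ => (r * Real.exp (a * s))⁻¹) (-a * ρ) s := by
    have h1 : HasDerivAt (fun s : ℝ => r * Real.exp (a * s)) (r * (Real.exp (a * s) * a)) s := by
      have := ((hasDerivAt_id s).const_mul a).exp.const_mul r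
      simpa using this
    have h2 := h1.inv (by positivity)
    refine h2.congr_deriv ?_
    rw [hρ]
    have := Real.exp_pos (a * s)
    field_simp
  have hc : HasDerivAt (fun s : ℝ => z - (y + s • v)) (-v) s := by
    have := (((hasDerivAt_id s).smul_const v).const_add y).const_sub z
    simpa using this
  have hwd : HasDerivAt (fun s : ℝ => (r * Real.exp (a * s))⁻¹ • (z - (y + s • v)))
      (ρ • (-v) + (-a * ρ) • (z - (y + s • v))) s := hq.smul hc
  have hbd := ((hdb w).hasFDerivAt).comp_hasDerivAt s hwd
  have hF := (hq.pow 3).mul hbd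
  have hpart : ∀ i : Fin 3, partialDeriv i (fun z =>
      scaledBump b (y + s • v) (r * Real.exp (a * s)) z * (v + a • (z - (y + s • v))) i) z =
      ρ ^ 3 * (ρ * fderiv ℝ b w (EuclideanSpace.single i 1)) * (v + a • (z - (y + s • v))) i +
        ρ ^ 3 * b w * a := by
    intro i
    have h1 : HasFDerivAt (fun z : E3 => (r * Real.exp (a * s))⁻¹ • (z - (y + s • v)))
        (ρ • ContinuousLinearMap.id ℝ E3) z :=
      ((hasFDerivAt_id z).sub_const _).const_smul ρ
    have h2 := (((hdb w).hasFDerivAt).comp z h1).const_mul (ρ ^ 3)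
    have h3 : HasFDerivAt (fun z : E3 => (v + a • (z - (y + s • v))) i)
        (a • (EuclideanSpace.proj i : E3 →L[ℝ] ℝ)) z := by
      have h4 : HasFDerivAt (fun z : E3 => v + a • (z - (y + s • v)))
          (a • ContinuousLinearMap.id ℝ E3) z :=
        (((hasFDerivAt_id z).sub_const _).const_smul a).const_add v
      exact ((EuclideanSpace.proj i : E3 →L[ℝ] ℝ).hasFDerivAt.comp z h4)
    have h5 := h2.mul h3
    have h6 := h5.fderiv
    simp only [partialDeriv]
    refine (congrArg (fun L : E3 →L[ℝ] ℝ => L (EuclideanSpace.single i 1)) h6).trans ?_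
    simp only [Function.comp_apply, ← hρ, ← hw]
    simp
    ring
  refine hF.congr_deriv ?_
  simp_rw [hpart]
  have hsum : ∑ i : Fin 3, fderiv ℝ b w (EuclideanSpace.single i 1) *
      (v + a • (z - (y + s • v))) i = fderiv ℝ b w (v + a • (z - (y + s • v))) := by
    set V := v + a • (z - (y + s • v))
    have hV : V = ∑ i : Fin 3, V i • EuclideanSpace.single i (1 : ℝ) := by
      ext j
      fin_cases j <;> simp [Fin.sum_univ_three]
    conv_rhs => rw [hV]
    rw [map_sum]
    exact Finset.sum_congr rfl fun i _ => by rw [map_smul, smul_eq_mul, mul_comm]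
  -- The divergence `3 * a` of the velocity field balances the derivative of the normalising factor,
  -- the inverse cube of the radius.
  have hsum' : ∑ i : Fin 3, (ρ ^ 3 * (ρ * fderiv ℝ b w (EuclideanSpace.single i 1)) *
      (v + a • (z - (y + s • v))) i + ρ ^ 3 * b w * a) =
      ρ ^ 4 * fderiv ℝ b w (v + a • (z - (y + s • v))) + 3 * (ρ ^ 3 * b w * a) := by
    rw [← hsum, Finset.sum_add_distrib, Finset.mul_sum]
    congr 1
    · exact Finset.sum_congr rfl fun i _ => by ring
    · simp
  rw [hsum']
  have hlin : ρ • (-v) + (-a * ρ) • (z - (y + s • v)) =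
      (-ρ) • (v + a • (z - (y + s • v))) := by
    module
  rw [hlin, map_smul]
  simp only [smul_eq_mul, Function.comp_apply, Pi.pow_apply, ← hρ, ← hw]
  push_cast
  ring

end IsUnitBump

/-! ### Variation and convergence of averages over bumps. -/

namespace IsUnitBump

variable {b : E3 → ℝ} {M : ℝ}

lemma contDiff_moving (hb : IsUnitBump b M) (y v : E3) {r : ℝ} (hr : 0 < r) (a : ℝ) :
    ContDiff ℝ 1 (fun p : ℝ × E3 => scaledBump b (y + p.1 • v) (r * Real.exp (a * p.1)) p.2) := by
  have hinv : ContDiff ℝ 1 (fun p : ℝ × E3 => (r * Real.exp (a * p.1))⁻¹) :=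
    (contDiff_const.mul (contDiff_const.mul contDiff_fst).exp).inv fun p => by positivity
  have hcen : ContDiff ℝ 1 (fun p : ℝ × E3 => p.2 - (y + p.1 • v)) :=
    contDiff_snd.sub (contDiff_const.add (contDiff_fst.smul contDiff_const))
  have hb1 : ContDiff ℝ 1 b := hb.smooth.of_le (by exact_mod_cast le_top)
  exact (hinv.pow 3).mul (hb1.comp (hinv.smul hcen))

/-- The change of the average of `u` along a moving bump is controlled by the gradient of `u`. -/
theorem abs_average_sub_le (hb : IsUnitBump b M) {Ω : Set E3} (hΩ : IsOpen Ω)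
    (hbd : Bornology.IsBounded Ω) {u : E3 → ℝ} {g : Fin 3 → E3 → ℝ}
    (hu : Integrable u (volume.restrict Ω)) (hg : ∀ i, Integrable (g i) (volume.restrict Ω))
    (hw : ∀ i, IsWeakDeriv Ω (Pi.single i 1) u (g i))
    {y v x : E3} {r a R ρ β : ℝ} (hr : 0 < r) (hρ : 0 < ρ)
    (hΩs : ∀ s ∈ Icc (0 : ℝ) 1, Metric.closedBall (y + s • v) (r * Real.exp (a * s)) ⊆ Ω)
    (hRs : ∀ s ∈ Icc (0 : ℝ) 1,
      Metric.closedBall (y + s • v) (r * Real.exp (a * s)) ⊆ Metric.closedBall x R)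
    (hρs : ∀ s ∈ Icc (0 : ℝ) 1, ρ ≤ r * Real.exp (a * s))
    (hβ : ∀ s ∈ Icc (0 : ℝ) 1, ‖v‖ + |a| * (r * Real.exp (a * s)) ≤ β) :
    |(∫ z in Ω, u z * scaledBump b (y + v) (r * Real.exp a) z) -
      ∫ z in Ω, u z * scaledBump b y r z| ≤
      (ρ⁻¹) ^ 3 * M * β * ∫ z in Metric.closedBall x R, ∑ i, |g i z| ∂(volume.restrict Ω) := by
  set ν : Measure E3 := volume.restrict Ω with hν
  set Ψ : ℝ × E3 → ℝ := fun p => scaledBump b (y + p.1 • v) (r * Real.exp (a * p.1)) p.2 with hΨ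
  have hΨc : ContDiff ℝ 1 Ψ := hb.contDiff_moving y v hr a
  have hΨd : Differentiable ℝ Ψ := hΨc.differentiable one_ne_zero
  set D : ℝ → E3 → ℝ := fun s z => fderiv ℝ Ψ (s, z) (1, 0) with hD
  have hDc : Continuous (Function.uncurry D) :=
    (hΨc.continuous_fderiv one_ne_zero).clm_apply continuous_const
  have hDd : ∀ s z, HasDerivAt (fun s => Ψ (s, z)) (D s z) s := by
    intro s z
    have h1 : HasDerivAt (fun s : ℝ => (s, z)) ((1 : ℝ), (0 : E3)) s :=
      (hasDerivAt_id s).prodMk (hasDerivAt_const s z)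
    exact (hΨd (s, z)).hasFDerivAt.comp_hasDerivAt s h1
  set m : ℝ → ℝ := fun s => ∫ z, u z * Ψ (s, z) ∂ν with hm
  have hmd : ∀ s, HasDerivAt m (∫ z, u z * D s z ∂ν) s := by
    intro s
    -- Since `Ω` is bounded, the kernel and its time derivative are bounded on a compact set, so a
    -- multiple of `‖u‖` dominates.
    obtain ⟨R₀, hR₀⟩ := hbd.subset_closedBall 0
    have hcomp : IsCompact (Icc (s - 1) (s + 1) ×ˢ Metric.closedBall (0 : E3) R₀) :=
      isCompact_Icc.prod (isCompact_closedBall _ _)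
    obtain ⟨C, hC⟩ := hcomp.exists_bound_of_continuousOn hDc.continuousOn
    obtain ⟨C', hC'⟩ := hcomp.exists_bound_of_continuousOn hΨc.continuous.continuousOn
    have hmem : ∀ᵐ z ∂ν, z ∈ Ω := ae_restrict_mem hΩ.measurableSet
    have cs : ∀ s, Continuous fun z : E3 => Ψ (s, z) := fun s =>
      hΨc.continuous.comp (Continuous.prodMk_right s)
    have cd : ∀ s, Continuous fun z : E3 => D s z := fun s =>
      hDc.comp (Continuous.prodMk_right s)
    refine (hasDerivAt_integral_of_dominated_loc_of_deriv_le (μ := ν) (bound := fun z => ‖u z‖ * C)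
      (F := fun s z => u z * Ψ (s, z)) (F' := fun s z => u z * D s z)
      (s := Icc (s - 1) (s + 1)) (Icc_mem_nhds (by linarith) (by linarith))
      (Filter.Eventually.of_forall fun s =>
        hu.aestronglyMeasurable.mul (cs s).aestronglyMeasurable)
      (hu.mul_bdd (c := C') (cs s).aestronglyMeasurable ?_)
      (hu.aestronglyMeasurable.mul (cd s).aestronglyMeasurable) ?_ (hu.norm.mul_const C) ?_).2
    · filter_upwards [hmem] with z hz
      exact hC' (s, z) ⟨⟨by linarith, by linarith⟩, hR₀ hz⟩
    · filter_upwards [hmem] with z hz t ht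
      rw [norm_mul]
      exact mul_le_mul_of_nonneg_left (hC (t, z) ⟨ht, hR₀ hz⟩) (norm_nonneg _)
    · exact Filter.Eventually.of_forall fun z t _ => (hDd t z).const_mul (u z)
  have hbound : ∀ s ∈ Icc (0 : ℝ) 1, ‖∫ z, u z * D s z ∂ν‖ ≤
      (ρ⁻¹) ^ 3 * M * β * ∫ z in Metric.closedBall x R, ∑ i, |g i z| ∂ν := by
    intro s hs
    set yₛ := y + s • v with hy
    set rₛ := r * Real.exp (a * s) with hrs
    have hrs0 : 0 < rₛ := by positivity
    set f := scaledBump b yₛ rₛ with hf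
    set B : E3 → E3 := fun z => v + a • (z - yₛ) with hB
    have hft : IsTestFunction Ω f := hb.isTestFunction_scaled hrs0 (hΩs s hs)
    have hBs : ∀ i, ContDiff ℝ ((⊤ : ℕ∞) : WithTop ℕ∞) (fun z => B z i) := by
      intro i
      have h1 : ContDiff ℝ ((⊤ : ℕ∞) : WithTop ℕ∞) B :=
        contDiff_const.add ((contDiff_id.sub contDiff_const).const_smul a)
      exact (EuclideanSpace.proj i : E3 →L[ℝ] ℝ).contDiff.comp h1
    have ht : ∀ i, IsTestFunction Ω (fun z => f z * B z i) := fun i => hft.mul_left (hBs i)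
    have hDeq : ∀ z, D s z = -∑ i, partialDeriv i (fun z => f z * B z i) z := fun z =>
      (hDd s z).unique (hb.hasDerivAt_scaled y v hr a s z)
    have hmulint : ∀ {k φ : E3 → ℝ}, Integrable k ν → IsTestFunction Ω φ →
        Integrable (fun z => k z * φ z) ν := by
      intro k φ hk hφ
      obtain ⟨C, hC⟩ := hφ.exists_bound
      exact hk.mul_bdd hφ.1.continuous.aestronglyMeasurable (Filter.Eventually.of_forall hC)
    -- The time derivative of the bump is `-div (f B)`, and `f B` has test functions as components;
    -- the weak gradient thus replaces the derivative of the kernel.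
    have hint : ∫ z, u z * D s z ∂ν = ∫ z, ∑ i, g i z * (f z * B z i) ∂ν := by
      simp_rw [hDeq, mul_neg, Finset.mul_sum]
      rw [integral_neg, integral_finsetSum _ fun i _ => hmulint hu ((ht i).partialDeriv i),
        integral_finsetSum _ fun i _ => hmulint (hg i) (ht i), ← Finset.sum_neg_distrib]
      refine Finset.sum_congr rfl fun i _ => ?_
      rw [(isWeakDeriv_single_iff.1 (hw i)).2.2 _ (ht i), neg_neg]
    rw [hint]
    have hGi : Integrable (fun z => ∑ i, |g i z|) ν :=
      integrable_finsetSum _ fun i _ => (hg i).abs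
    rw [← integral_const_mul, ← integral_indicator Metric.isClosed_closedBall.measurableSet]
    refine norm_integral_le_of_norm_le
      ((hGi.const_mul _).indicator Metric.isClosed_closedBall.measurableSet)
      (Filter.Eventually.of_forall fun z => ?_)
    by_cases hz : z ∈ Metric.closedBall yₛ rₛ
    · rw [indicator_of_mem (hRs s hs hz), Finset.mul_sum]
      refine (norm_sum_le _ _).trans (Finset.sum_le_sum fun i _ => ?_)
      rw [Real.norm_eq_abs, abs_mul, mul_comm]
      refine mul_le_mul_of_nonneg_right ?_ (abs_nonneg _)
      rw [abs_mul, abs_of_nonneg (hb.scaled_nonneg yₛ hrs0 z)]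
      have hM := hb.bound_nonneg
      refine mul_le_mul ((hb.scaled_le yₛ hrs0 z).trans
        (mul_le_mul_of_nonneg_right ?_ hM)) ?_ (abs_nonneg _) (by positivity)
      · exact pow_le_pow_left₀ (by positivity) (inv_anti₀ hρ (hρs s hs)) 3
      · refine le_trans (PiLp.norm_apply_le (B z) i) (le_trans ?_ (hβ s hs))
        refine (norm_add_le _ _).trans (add_le_add le_rfl ?_)
        rw [norm_smul, Real.norm_eq_abs]
        refine mul_le_mul_of_nonneg_left ?_ (abs_nonneg a)
        rwa [← dist_eq_norm]
    · have hz0 : ‖∑ i, g i z * (f z * B z i)‖ = 0 := by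
        simp [hf, hb.scaled_eq_zero hrs0 hz]
      rw [hz0]
      refine indicator_nonneg (fun z _ => ?_) z
      have hβ0 : 0 ≤ β := le_trans (by positivity) (hβ s hs)
      have hM := hb.bound_nonneg
      exact mul_nonneg (by positivity) (Finset.sum_nonneg fun i _ => abs_nonneg _)
  have := norm_image_sub_le_of_norm_deriv_le_segment_01' (f := m)
    (fun s _ => (hmd s).hasDerivWithinAt) fun s hs => hbound s (Ico_subset_Icc_self hs)
  simpa [hm, hΨ] using this

/-- The averages of `u` along a nontangential sequence of shrinking balls converge to `u` almost
everywhere. -/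
theorem ae_tendsto_average (hb : IsUnitBump b M) {Ω : Set E3} (hΩ : IsOpen Ω) {u : E3 → ℝ}
    (hu : Integrable u (volume.restrict Ω)) (K : ℝ) :
    ∀ᵐ x ∂(volume.restrict Ω), ∀ (w : ℕ → E3) (δ : ℕ → ℝ),
      Filter.Tendsto δ Filter.atTop (nhdsWithin 0 (Ioi 0)) → (∀ j, 0 < δ j) →
      (∀ j, x ∈ Metric.closedBall (w j) (K * δ j)) →
      Filter.Tendsto (fun j => ∫ z in Ω, u z * scaledBump b (w j) (δ j) z) Filter.atTop
        (nhds (u x)) := by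
  have hU : Integrable (Ω.indicator u) := (integrable_indicator_iff hΩ.measurableSet).2 hu
  rw [ae_restrict_iff' hΩ.measurableSet]
  filter_upwards [IsUnifLocDoublingMeasure.ae_tendsto_average_norm_sub volume
    hU.locallyIntegrable K] with x hx hxΩ w δ hδ hδ0 hmem
  have h1 := hx (ι := ℕ) w δ hδ (Filter.Eventually.of_forall hmem)
  rw [← tendsto_sub_nhds_zero_iff]
  -- `c` is the factor by which the bump, bounded by `M / δ ^ 3`, exceeds the uniform density on its
  -- ball.
  set c : ℝ := M * volume.real (Metric.ball (0 : E3) 1) with hc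
  have h2 := h1.const_mul c
  rw [mul_zero] at h2
  refine squeeze_zero_norm (fun j => ?_) h2
  have ht : IsTestFunction univ (scaledBump b (w j) (δ j)) :=
    hb.isTestFunction_scaled (hδ0 j) (subset_univ _)
  have hsi : Integrable (scaledBump b (w j) (δ j)) :=
    ht.1.continuous.integrable_of_hasCompactSupport ht.2.1
  have hui : Integrable (fun z => Ω.indicator u z * scaledBump b (w j) (δ j) z) := by
    obtain ⟨C, hC⟩ := ht.exists_bound
    exact hU.mul_bdd ht.1.continuous.aestronglyMeasurable (Filter.Eventually.of_forall hC)
  have e1 : (∫ z in Ω, u z * scaledBump b (w j) (δ j) z) - u x =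
      ∫ z, (Ω.indicator u z - Ω.indicator u x) * scaledBump b (w j) (δ j) z := by
    simp_rw [sub_mul]
    rw [integral_sub hui (hsi.const_mul _), integral_const_mul, hb.integral_scaled _ (hδ0 j),
      integral_indicator_mul hΩ, indicator_of_mem hxΩ, mul_one]
  rw [e1, setAverage_eq, Measure.addHaar_real_closedBall _ _ (hδ0 j).le]
  have hfr : Module.finrank ℝ E3 = 3 := by simp
  have hvol : 0 < volume.real (Metric.ball (0 : E3) 1) :=
    ENNReal.toReal_pos (Metric.measure_ball_pos _ _ one_pos).ne' measure_ball_lt_top.ne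
  have e2 : c * ((δ j ^ Module.finrank ℝ E3 * volume.real (Metric.ball (0 : E3) 1))⁻¹ •
      ∫ z in Metric.closedBall (w j) (δ j), ‖Ω.indicator u z - Ω.indicator u x‖) =
      ∫ z in Metric.closedBall (w j) (δ j),
        ((δ j)⁻¹ ^ 3 * M) * ‖Ω.indicator u z - Ω.indicator u x‖ := by
    rw [integral_const_mul, hfr, hc, smul_eq_mul, ← mul_assoc]
    congr 1
    have := hδ0 j
    field_simp
  rw [e2, ← integral_indicator Metric.isClosed_closedBall.measurableSet]
  refine norm_integral_le_of_norm_le ?_ (Filter.Eventually.of_forall fun z => ?_)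
  · rw [integrable_indicator_iff Metric.isClosed_closedBall.measurableSet]
    refine Integrable.const_mul (Integrable.norm ?_) _
    exact (hU.integrableOn).sub
      (integrableOn_const measure_closedBall_lt_top.ne)
  · by_cases hz : z ∈ Metric.closedBall (w j) (δ j)
    · rw [indicator_of_mem hz, norm_mul, mul_comm]
      refine mul_le_mul_of_nonneg_right ?_ (norm_nonneg _)
      rw [Real.norm_of_nonneg (hb.scaled_nonneg _ (hδ0 j) z)]
      exact hb.scaled_le _ (hδ0 j) z
    · rw [indicator_of_notMem hz, hb.scaled_eq_zero (hδ0 j) hz]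
      simp

end IsUnitBump

/-! ### Sobolev embeddings -/

/-- Pointwise bound of a function by a discretized Riesz potential of its weak gradient. -/
theorem exists_potential_bound {Ω : Set E3} (hΩ : IsOpen Ω) (hbd : Bornology.IsBounded Ω)
    (hL : HasLipschitzBoundary Ω) :
    ∃ μ D R : ℝ, 0 < μ ∧ μ < 1 ∧ 0 ≤ D ∧ 0 < R ∧ ∀ (u : E3 → ℝ) (g : Fin 3 → E3 → ℝ),
      Integrable u (volume.restrict Ω) → (∀ i, Integrable (g i) (volume.restrict Ω)) →
      (∀ i, IsWeakDeriv Ω (Pi.single i 1) u (g i)) →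
      ∃ A : ℝ≥0, ∀ᵐ x ∂(volume.restrict Ω), ‖u x‖ₑ ≤ A + ∑' k : ℕ,
        ENNReal.ofReal (D * (((μ ^ 4) ^ k)⁻¹) ^ 2) *
          ∫⁻ z in Metric.closedBall x (R * (μ ^ 4) ^ k), ‖∑ i, |g i z|‖ₑ ∂(volume.restrict Ω) := by
  obtain ⟨μ, c, C, hμ0, hμ1, hc, hC, hchain⟩ := exists_chain hΩ hbd hL
  obtain ⟨b, M, hb⟩ := exists_isUnitBump
  set l : ℝ := μ ^ 4 with hl
  have hl0 : 0 < l := pow_pos hμ0 4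
  have hl1 : l < 1 := pow_lt_one₀ hμ0.le hμ1 (by norm_num)
  have hlog : Real.log l ≤ 0 := Real.log_nonpos hl0.le hl1.le
  set β : ℝ := c / 4 + |Real.log l| * (c / 2) with hβ
  have hβ0 : 0 ≤ β := by positivity
  have hM := hb.bound_nonneg
  refine ⟨μ, ((c / 2 * l)⁻¹) ^ 3 * M * β, C + c, hμ0, hμ1, by positivity, by positivity,
    fun u g hu hg hw => ?_⟩
  set ν : Measure E3 := volume.restrict Ω with hν
  refine ⟨Real.toNNReal (((c / 2)⁻¹) ^ 3 * M * ∫ z, ‖u z‖ ∂ν), ?_⟩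
  -- The exceptional null set serves all admissible sequences of balls at once, so the chain may be
  -- chosen after `x`. The factor `2 * C / c` compares the distance `C * l ^ k` with the radius `c /
  -- 2 * l ^ k`.
  filter_upwards [hb.ae_tendsto_average hΩ hu (2 * C / c), ae_restrict_mem hΩ.measurableSet]
    with x hx hxΩ
  obtain ⟨y, hy⟩ := hchain x hxΩ
  have hlk : ∀ k, 0 < l ^ k := fun k => pow_pos hl0 k
  -- Half the radius of the chain balls leaves room for the centre to move by `c / 4 * l ^ k`
  -- without leaving `Ω`.
  set r : ℕ → ℝ := fun k => c / 2 * l ^ k with hr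
  have hr0 : ∀ k, 0 < r k := fun k => mul_pos (by positivity) (hlk k)
  set m : ℕ → ℝ := fun k => ∫ z, u z * scaledBump b (y k) (r k) z ∂ν with hm
  set T : ℕ → ℝ≥0∞ := fun k => ENNReal.ofReal (((c / 2 * l)⁻¹) ^ 3 * M * β * ((l ^ k)⁻¹) ^ 2) *
    ∫⁻ z in Metric.closedBall x ((C + c) * l ^ k), ‖∑ i, |g i z|‖ₑ ∂ν with hT
  have hlim : Filter.Tendsto m Filter.atTop (nhds (u x)) := by
    refine hx y r ?_ hr0 fun j => ?_
    · refine tendsto_nhdsWithin_iff.2 ⟨?_, Filter.Eventually.of_forall hr0⟩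
      have := (tendsto_pow_atTop_nhds_zero_of_lt_one hl0.le hl1).const_mul (c / 2)
      rwa [mul_zero] at this
    · rw [Metric.mem_closedBall, dist_comm]
      refine (hy j).1.trans_eq ?_
      simp only [hr]
      field_simp
  have hstep : ∀ k, ‖m (k + 1) - m k‖ₑ ≤ T k := by
    intro k
    have hexp : ∀ s ∈ Icc (0 : ℝ) 1, l ≤ Real.exp (Real.log l * s) ∧
        Real.exp (Real.log l * s) ≤ 1 := by
      intro s hs
      constructor
      · conv_lhs => rw [← Real.exp_log hl0]
        refine Real.exp_le_exp.2 ?_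
        have := mul_le_mul_of_nonpos_left hs.2 hlog
        linarith
      · exact Real.exp_le_one_iff.2 (mul_nonpos_of_nonpos_of_nonneg hlog hs.1)
    have hrs : ∀ s ∈ Icc (0 : ℝ) 1, r k * Real.exp (Real.log l * s) ≤ r k := fun s hs =>
      mul_le_of_le_one_right (hr0 k).le (hexp s hs).2
    have hdist : ∀ s ∈ Icc (0 : ℝ) 1,
        dist (y k + s • (y (k + 1) - y k)) (y k) ≤ c / 4 * l ^ k := by
      intro s hs
      rw [dist_eq_norm, add_sub_cancel_left, norm_smul, Real.norm_of_nonneg hs.1, ← dist_eq_norm]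
      exact (mul_le_of_le_one_left dist_nonneg hs.2).trans (hy k).2.2
    -- The rate `log l` shrinks `r k` to exactly `r (k + 1)` in unit time. The inverse cube of the
    -- smallest radius times the velocity bound `β * l ^ k` produces the weight `(l ^ k)⁻¹ ^ 2`.
    have key := hb.abs_average_sub_le hΩ hbd hu hg hw (y := y k) (v := y (k + 1) - y k) (x := x)
      (r := r k) (a := Real.log l) (R := (C + c) * l ^ k) (ρ := c / 2 * l * l ^ k)
      (β := β * l ^ k) (hr0 k) (mul_pos (by positivity) (hlk k)) ?_ ?_ ?_ ?_
    · rw [add_sub_cancel, Real.exp_log hl0] at key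
      have hrk : r k * l = r (k + 1) := by
        simp only [hr]
        ring
      rw [hrk] at key
      have hco : ((c / 2 * l * l ^ k)⁻¹) ^ 3 * M * (β * l ^ k) =
          ((c / 2 * l)⁻¹) ^ 3 * M * β * ((l ^ k)⁻¹) ^ 2 := by
        have := hlk k
        field_simp
      rw [hco] at key
      rw [Real.enorm_eq_ofReal_abs]
      refine (ENNReal.ofReal_le_ofReal key).trans ?_
      have := hlk k
      rw [ENNReal.ofReal_mul (by positivity)]
      refine mul_le_mul_right ?_ _
      refine le_trans ?_ (enorm_integral_le_lintegral_enorm _)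
      rw [Real.enorm_eq_ofReal_abs]
      exact ENNReal.ofReal_le_ofReal (le_abs_self _)
    · intro s hs
      refine (Metric.closedBall_subset_closedBall' ?_).trans (hy k).2.1
      have h1 := hrs s hs
      have h2 := hdist s hs
      have h3 := mul_pos hc (hlk k)
      simp only [hr] at h1 ⊢
      linarith
    · intro s hs
      refine Metric.closedBall_subset_closedBall' ?_
      have h1 := hrs s hs
      have h2 := hdist s hs
      have h3 := mul_pos hc (hlk k)
      have h4 := dist_triangle (y k + s • (y (k + 1) - y k)) (y k) x
      have h5 := (hy k).1
      simp only [hr] at h1 ⊢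
      linarith
    · intro s hs
      have := mul_le_mul_of_nonneg_left (hexp s hs).1 (hr0 k).le
      simp only [hr] at this ⊢
      linarith
    · intro s hs
      rw [← dist_eq_norm, hβ, add_mul]
      refine add_le_add (hy k).2.2 ?_
      rw [mul_assoc |Real.log l| (c / 2)]
      exact mul_le_mul_of_nonneg_left (hrs s hs) (abs_nonneg _)
  have hm0 : ‖m 0‖ₑ ≤ Real.toNNReal (((c / 2)⁻¹) ^ 3 * M * ∫ z, ‖u z‖ ∂ν) := by
    rw [Real.enorm_eq_ofReal_abs]
    refine ENNReal.ofReal_le_ofReal ?_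
    rw [← integral_const_mul]
    refine norm_integral_le_of_norm_le (f := fun z => u z * scaledBump b (y 0) (r 0) z)
      (hu.norm.const_mul _) (Filter.Eventually.of_forall fun z => ?_)
    rw [norm_mul, mul_comm]
    refine mul_le_mul_of_nonneg_right ?_ (norm_nonneg _)
    rw [Real.norm_of_nonneg (hb.scaled_nonneg _ (hr0 0) z)]
    simpa [hr] using hb.scaled_le (y 0) (hr0 0) z
  have hmk : ∀ k, ‖m k‖ₑ ≤ ‖m 0‖ₑ + ∑ j ∈ Finset.range k, T j := by
    intro k
    induction k with
    | zero => simp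
    | succ k ih =>
      rw [Finset.sum_range_succ, ← add_assoc]
      have h1 : m (k + 1) = m k + (m (k + 1) - m k) := by ring
      rw [h1]
      exact (enorm_add_le _ _).trans (add_le_add ih (hstep k))
  refine le_of_tendsto hlim.enorm (Filter.Eventually.of_forall fun k => ?_)
  exact (hmk k).trans (add_le_add hm0 (ENNReal.sum_le_tsum _))

/-- Hölder's inequality on a ball. -/
lemma lintegral_closedBall_le {ν : Measure E3} (hν : ν ≤ volume) {G : E3 → ℝ}
    (hG : AEStronglyMeasurable G ν) {p : ℝ≥0∞} (hp : 1 ≤ p) (x : E3) {r : ℝ} (hr : 0 ≤ r) :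
    ∫⁻ z in Metric.closedBall x r, ‖G z‖ₑ ∂ν ≤
      eLpNorm G p (ν.restrict (Metric.closedBall x r)) *
        (ENNReal.ofReal (r ^ 3) * volume (Metric.ball (0 : E3) 1)) ^ (1 - 1 / p.toReal) := by
  rw [← eLpNorm_one_eq_lintegral_enorm]
  refine (eLpNorm_le_eLpNorm_mul_rpow_measure_univ hp hG.restrict).trans ?_
  have hd : Module.finrank ℝ E3 = 3 := by simp
  have h1 : (ν.restrict (Metric.closedBall x r)) univ ≤
      ENNReal.ofReal (r ^ 3) * volume (Metric.ball (0 : E3) 1) := by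
    rw [Measure.restrict_apply_univ]
    refine (hν _).trans_eq ?_
    rw [Measure.addHaar_closedBall _ _ hr, hd]
  rw [ENNReal.toReal_one, div_one]
  refine mul_le_mul_right (ENNReal.rpow_le_rpow h1 ?_) _
  rcases eq_or_ne p ∞ with rfl | hp'
  · simp
  · have : 1 ≤ p.toReal := by
      rw [← ENNReal.toReal_one]
      exact ENNReal.toReal_mono hp' hp
    rw [sub_nonneg, div_le_one (by linarith)]
    exact this

/-- Writing the ratio of radii as `μ ^ 4` makes `12 * a` an integer for the Hölder exponents `a = 5
/ 6` and `a = 2 / 3` used below. -/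
lemma rpow_ball_volume {μ R : ℝ} (hμ : 0 < μ) (hR : 0 < R) (V : ℝ≥0∞) (k : ℕ) {a : ℝ}
    (ha : 0 ≤ a) :
    (ENNReal.ofReal ((R * (μ ^ 4) ^ k) ^ 3) * V) ^ a =
      (ENNReal.ofReal (R ^ 3) * V) ^ a * (ENNReal.ofReal (μ ^ k)) ^ (12 * a) := by
  have h1 : (R * (μ ^ 4) ^ k) ^ 3 = R ^ 3 * (μ ^ k) ^ 12 := by ring
  rw [h1, ENNReal.ofReal_mul (by positivity), mul_right_comm, ENNReal.mul_rpow_of_nonneg _ _ ha,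
    ENNReal.ofReal_pow (p := μ ^ k) (by positivity), ENNReal.rpow_mul]
  norm_cast

lemma tsum_ofReal_pow_lt_top {μ : ℝ} (hμ0 : 0 < μ) (hμ1 : μ < 1) {n : ℕ} (hn : n ≠ 0) :
    ∑' k : ℕ, ENNReal.ofReal (μ ^ k) ^ n < ∞ := by
  have h1 : ∀ k : ℕ, ENNReal.ofReal (μ ^ k) ^ n = (ENNReal.ofReal (μ ^ n)) ^ k := by
    intro k
    rw [← ENNReal.ofReal_pow (by positivity), ← ENNReal.ofReal_pow (by positivity),
      ← pow_mul, ← pow_mul, mul_comm]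
  simp_rw [h1]
  rw [ENNReal.tsum_geometric, ENNReal.inv_lt_top, tsub_pos_iff_lt]
  rw [← ENNReal.ofReal_one]
  exact (ENNReal.ofReal_lt_ofReal_iff one_pos).2 (pow_lt_one₀ hμ0.le hμ1 hn)

/-- The potential weight is `μ ^ (-8k)`; `n` counts the powers of `μ ^ k` that survive it. -/
lemma ofReal_inv_sq_mul {μ D : ℝ} (hμ : 0 < μ) (hD : 0 ≤ D) (k n : ℕ) :
    ENNReal.ofReal (D * (((μ ^ 4) ^ k)⁻¹) ^ 2) * ENNReal.ofReal (μ ^ k) ^ (8 + n) =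
      ENNReal.ofReal D * ENNReal.ofReal (μ ^ k) ^ n := by
  rw [← ENNReal.ofReal_pow (by positivity), ← ENNReal.ofReal_pow (by positivity),
    ← ENNReal.ofReal_mul (by positivity), ← ENNReal.ofReal_mul hD]
  congr 1
  have h1 : (μ ^ 4) ^ k = (μ ^ k) ^ 4 := by ring
  have := pow_pos hμ k
  rw [h1, pow_add]
  field_simp

/-- `W^{1,6}(Ω) ⊆ L^∞(Ω)`. -/
theorem memLp_top_of_weakDeriv_memLp_six {Ω : Set E3} (hΩ : IsOpen Ω)
    (hbd : Bornology.IsBounded Ω) (hL : HasLipschitzBoundary Ω) {u : E3 → ℝ}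
    {g : Fin 3 → E3 → ℝ} (hu : Integrable u (volume.restrict Ω))
    (hg : ∀ i, MemLp (g i) 6 (volume.restrict Ω))
    (hw : ∀ i, IsWeakDeriv Ω (Pi.single i 1) u (g i)) :
    MemLp u ∞ (volume.restrict Ω) := by
  have hfin : IsFiniteMeasure (volume.restrict Ω) := ⟨by simpa using hbd.measure_lt_top⟩
  obtain ⟨μ, D, R, hμ0, hμ1, hD, hR, H⟩ := exists_potential_bound hΩ hbd hL
  obtain ⟨A, hA⟩ := H u g hu (fun i => (hg i).integrable (by norm_num)) hw
  set ν : Measure E3 := volume.restrict Ω with hν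
  have hG : MemLp (fun z => ∑ i, |g i z|) 6 ν := memLp_finsetSum _ fun i _ => (hg i).norm
  set N := eLpNorm (fun z => ∑ i, |g i z|) 6 ν with hN
  set V := (ENNReal.ofReal (R ^ 3) * volume (Metric.ball (0 : E3) 1)) ^ (1 - 1 / (6 : ℝ)) with hV
  have hVt : V < ∞ := ENNReal.rpow_lt_top_of_nonneg (by norm_num)
    (ENNReal.mul_ne_top ENNReal.ofReal_ne_top measure_ball_lt_top.ne)
  set S : ℝ≥0∞ := A + N * V * ENNReal.ofReal D * ∑' k : ℕ, ENNReal.ofReal (μ ^ k) ^ 2 with hS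
  have hSt : S < ∞ := ENNReal.add_lt_top.2 ⟨ENNReal.coe_lt_top, ENNReal.mul_lt_top
    (ENNReal.mul_lt_top (ENNReal.mul_lt_top hG.2 hVt) ENNReal.ofReal_lt_top)
    (tsum_ofReal_pow_lt_top hμ0 hμ1 two_ne_zero)⟩
  refine ⟨hu.aestronglyMeasurable, ?_⟩
  refine lt_of_le_of_lt ?_ hSt
  rw [eLpNorm_exponent_top]
  refine essSup_le_of_ae_le _ ?_
  filter_upwards [hA] with x hx
  refine hx.trans (add_le_add le_rfl ?_)
  rw [← ENNReal.tsum_mul_left]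
  refine ENNReal.tsum_le_tsum fun k => ?_
  have h1 := lintegral_closedBall_le (ν := ν) Measure.restrict_le_self hG.1 (p := 6)
    (by norm_num) x (r := R * (μ ^ 4) ^ k) (by positivity)
  have h2 : (6 : ℝ≥0∞).toReal = 6 := by norm_num
  rw [h2, rpow_ball_volume hμ0 hR _ k (by norm_num), ← hV] at h1
  have h3 : eLpNorm (fun z => ∑ i, |g i z|) 6
      (ν.restrict (Metric.closedBall x (R * (μ ^ 4) ^ k))) ≤ N :=
    eLpNorm_mono_measure _ Measure.restrict_le_self
  -- Of the ten powers of `μ ^ k`, eight cancel the weight and two make the series geometric.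
  have h4 : (12 : ℝ) * (1 - 1 / 6) = ((8 + 2 : ℕ) : ℝ) := by norm_num
  rw [h4, ENNReal.rpow_natCast] at h1
  calc _ ≤ ENNReal.ofReal (D * (((μ ^ 4) ^ k)⁻¹) ^ 2) *
        (N * (V * ENNReal.ofReal (μ ^ k) ^ (8 + 2))) :=
        mul_le_mul_right (h1.trans (mul_le_mul_left h3 _)) _
    _ = N * V * (ENNReal.ofReal (D * (((μ ^ 4) ^ k)⁻¹) ^ 2) *
        ENNReal.ofReal (μ ^ k) ^ (8 + 2)) := by ring
    _ = _ := by
        rw [ofReal_inv_sq_mul hμ0 hD]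
        ring

/-- By Tonelli, each `z` is counted with the measure of the set of centres `x` within `r` of it. -/
lemma lintegral_lintegral_closedBall_le {ν : Measure E3} [SFinite ν] (hν : ν ≤ volume)
    {f : E3 → ℝ≥0∞} (hf : AEMeasurable f ν) {r : ℝ} (hr : 0 ≤ r) :
    AEMeasurable (fun x => ∫⁻ z in Metric.closedBall x r, f z ∂ν) ν ∧
    ∫⁻ x, ∫⁻ z in Metric.closedBall x r, f z ∂ν ∂ν ≤
      (ENNReal.ofReal (r ^ 3) * volume (Metric.ball (0 : E3) 1)) * ∫⁻ z, f z ∂ν := by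
  have hd : Module.finrank ℝ E3 = 3 := by simp
  have hs : MeasurableSet {p : E3 × E3 | dist p.2 p.1 ≤ r} :=
    (isClosed_le (continuous_snd.dist continuous_fst) continuous_const).measurableSet
  have hm : AEMeasurable (fun p : E3 × E3 =>
      {p : E3 × E3 | dist p.2 p.1 ≤ r}.indicator (fun p => f p.2) p) (ν.prod ν) :=
    (hf.comp_snd).indicator hs
  have e : ∀ x, ∫⁻ z in Metric.closedBall x r, f z ∂ν =
      ∫⁻ z, {p : E3 × E3 | dist p.2 p.1 ≤ r}.indicator (fun p => f p.2) (x, z) ∂ν := by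
    intro x
    rw [← lintegral_indicator Metric.isClosed_closedBall.measurableSet]
    rfl
  simp_rw [e]
  refine ⟨hm.lintegral_prod_right', ?_⟩
  rw [lintegral_lintegral_swap hm]
  have hVt : ENNReal.ofReal (r ^ 3) * volume (Metric.ball (0 : E3) 1) ≠ ∞ :=
    ENNReal.mul_ne_top ENNReal.ofReal_ne_top measure_ball_lt_top.ne
  rw [← lintegral_const_mul' _ _ hVt]
  refine lintegral_mono fun z => ?_
  have e2 : ∀ x, {p : E3 × E3 | dist p.2 p.1 ≤ r}.indicator (fun p => f p.2) (x, z) =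
      (Metric.closedBall z r).indicator (fun _ => f z) x := by
    intro x
    by_cases h : dist z x ≤ r
    · rw [indicator_of_mem (by exact h), indicator_of_mem (by rwa [Metric.mem_closedBall, dist_comm])]
    · rw [indicator_of_notMem (by exact h),
        indicator_of_notMem (by rwa [Metric.mem_closedBall, dist_comm])]
  simp_rw [e2]
  rw [lintegral_indicator_const Metric.isClosed_closedBall.measurableSet, mul_comm]
  refine mul_le_mul_left ((hν _).trans_eq ?_) _
  rw [Measure.addHaar_closedBall _ _ hr, hd]

/-- `W^{1,3}(Ω) ⊆ L^6(Ω)`. -/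
theorem memLp_six_of_weakDeriv_memLp_three {Ω : Set E3} (hΩ : IsOpen Ω)
    (hbd : Bornology.IsBounded Ω) (hL : HasLipschitzBoundary Ω) {u : E3 → ℝ}
    {g : Fin 3 → E3 → ℝ} (hu : Integrable u (volume.restrict Ω))
    (hg : ∀ i, MemLp (g i) 3 (volume.restrict Ω))
    (hw : ∀ i, IsWeakDeriv Ω (Pi.single i 1) u (g i)) :
    MemLp u 6 (volume.restrict Ω) := by
  have hfin : IsFiniteMeasure (volume.restrict Ω) := ⟨by simpa using hbd.measure_lt_top⟩
  obtain ⟨μ, D, R, hμ0, hμ1, hD, hR, H⟩ := exists_potential_bound hΩ hbd hL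
  obtain ⟨A, hA⟩ := H u g hu (fun i => (hg i).integrable (by norm_num)) hw
  set ν : Measure E3 := volume.restrict Ω with hν
  have hνle : ν ≤ volume := Measure.restrict_le_self
  have hG : MemLp (fun z => ∑ i, |g i z|) 3 ν := memLp_finsetSum _ fun i _ => (hg i).norm
  set G : E3 → ℝ := fun z => ∑ i, |g i z| with hGdef
  have h3r : (3 : ℝ≥0∞).toReal = 3 := by norm_num
  have hGm : AEMeasurable (fun z => ‖G z‖ₑ ^ (3 : ℝ)) ν := hG.1.enorm.pow_const _
  set N := ∫⁻ z, ‖G z‖ₑ ^ (3 : ℝ) ∂ν with hN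
  have hNt : N < ∞ := by
    have := lintegral_rpow_enorm_lt_top_of_eLpNorm_lt_top (by norm_num) (by norm_num) hG.2
    rwa [h3r] at this
  set W₀ := ENNReal.ofReal (R ^ 3) * volume (Metric.ball (0 : E3) 1) with hW₀
  have hW₀t : W₀ < ∞ := ENNReal.mul_lt_top ENNReal.ofReal_lt_top measure_ball_lt_top
  set V := W₀ ^ (1 - 1 / (3 : ℝ)) with hV
  have hVt : V < ∞ := ENNReal.rpow_lt_top_of_nonneg (by norm_num) hW₀t.ne
  set q : ℕ → ℝ≥0∞ := fun k => ENNReal.ofReal (μ ^ k) with hq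
  have hq0 : ∀ k, q k ≠ 0 := fun k => (ENNReal.ofReal_pos.2 (pow_pos hμ0 k)).ne'
  have hqt : ∀ k, q k ≠ ∞ := fun k => ENNReal.ofReal_ne_top
  set S : ℕ → E3 → ℝ≥0∞ := fun k x =>
    ∫⁻ z in Metric.closedBall x (R * (μ ^ 4) ^ k), ‖G z‖ₑ ^ (3 : ℝ) ∂ν with hS
  have hSm : ∀ k, AEMeasurable (S k) ν := fun k =>
    (lintegral_lintegral_closedBall_le hνle hGm (by positivity)).1
  -- The weights `q k ^ (-6)` are affordable: integrating `S k` over `x` gains the ball volume `q k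
  -- ^ 12`, so `W` is integrable. Conversely `S k ≤ q k ^ 6 * W`, whose sixth root supplies a factor
  -- `q k`.
  set W : E3 → ℝ≥0∞ := fun x => ∑' k, ((q k)⁻¹) ^ 6 * S k x with hW
  have hWt : ∫⁻ x, W x ∂ν < ∞ := by
    have h1 : ∫⁻ x, W x ∂ν ≤ ∑' k, W₀ * N * (q k) ^ 6 := by
      rw [hW, lintegral_tsum fun k => (hSm k).const_mul _]
      refine ENNReal.tsum_le_tsum fun k => ?_
      rw [lintegral_const_mul' _ _ (ENNReal.pow_ne_top (ENNReal.inv_ne_top.2 (hq0 k)))]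
      have h2 := (lintegral_lintegral_closedBall_le hνle hGm
        (r := R * (μ ^ 4) ^ k) (by positivity)).2
      have h3 := rpow_ball_volume hμ0 hR (volume (Metric.ball (0 : E3) 1)) k (a := 1) zero_le_one
      have h4 : (12 : ℝ) * 1 = ((12 : ℕ) : ℝ) := by norm_num
      rw [h4, ENNReal.rpow_natCast, ENNReal.rpow_one, ENNReal.rpow_one] at h3
      rw [h3] at h2
      have h5 : ((q k)⁻¹) ^ 6 * (q k) ^ 12 = (q k) ^ 6 := by
        rw [show 12 = 6 + 6 from rfl, pow_add, ← mul_assoc, ← mul_pow,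
          ENNReal.inv_mul_cancel (hq0 k) (hqt k), one_pow, one_mul]
      calc _ ≤ ((q k)⁻¹) ^ 6 * (W₀ * (q k) ^ 12 * N) := mul_le_mul_right h2 _
        _ = W₀ * N * (((q k)⁻¹) ^ 6 * (q k) ^ 12) := by ring
        _ = _ := by rw [h5]
    refine h1.trans_lt ?_
    rw [ENNReal.tsum_mul_left]
    exact ENNReal.mul_lt_top (ENNReal.mul_lt_top hW₀t hNt)
      (tsum_ofReal_pow_lt_top hμ0 hμ1 (by norm_num))
  set c₂ := ENNReal.ofReal D * V * N ^ (1 / 6 : ℝ) * ∑' k, q k ^ 1 with hc₂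
  have hc₂t : c₂ < ∞ := ENNReal.mul_lt_top (ENNReal.mul_lt_top
    (ENNReal.mul_lt_top ENNReal.ofReal_lt_top hVt)
    (ENNReal.rpow_lt_top_of_nonneg (by norm_num) hNt.ne))
    (tsum_ofReal_pow_lt_top hμ0 hμ1 one_ne_zero)
  have hux : ∀ᵐ x ∂ν, ‖u x‖ₑ ≤ A + c₂ * W x ^ (1 / 6 : ℝ) := by
    filter_upwards [hA] with x hx
    refine hx.trans (add_le_add le_rfl ?_)
    rw [hc₂, mul_right_comm, ← ENNReal.tsum_mul_left]
    refine ENNReal.tsum_le_tsum fun k => ?_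
    have h1 := lintegral_closedBall_le hνle hG.1 (p := 3)
      (by norm_num) x (r := R * (μ ^ 4) ^ k) (by positivity)
    rw [h3r, rpow_ball_volume hμ0 hR _ k (by norm_num), ← hV] at h1
    have h4 : (12 : ℝ) * (1 - 1 / 3) = ((8 + 0 : ℕ) : ℝ) := by norm_num
    rw [h4, ENNReal.rpow_natCast] at h1
    -- For `p = 3` no power of `q k` is left over. The local norm is split into two equal factors:
    -- one is bounded by the global norm, the other by `q k * W x ^ (1 / 6)`.
    have h5 : eLpNorm G 3 (ν.restrict (Metric.closedBall x (R * (μ ^ 4) ^ k))) =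
        (S k x) ^ (1 / 6 : ℝ) * (S k x) ^ (1 / 6 : ℝ) := by
      rw [eLpNorm_eq_lintegral_rpow_enorm_toReal (by norm_num) (by norm_num), h3r,
        ← ENNReal.rpow_add_of_nonneg _ _ (by norm_num) (by norm_num)]
      norm_num [hS]
    have h6 : S k x ≤ N := lintegral_mono' Measure.restrict_le_self le_rfl
    have h7 : S k x ≤ (q k) ^ 6 * W x := by
      have h8 : ((q k)⁻¹) ^ 6 * S k x ≤ W x := ENNReal.le_tsum k
      calc S k x = (q k) ^ 6 * (((q k)⁻¹) ^ 6 * S k x) := by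
            rw [← mul_assoc, ← mul_pow, ENNReal.mul_inv_cancel (hq0 k) (hqt k), one_pow, one_mul]
        _ ≤ _ := mul_le_mul_right h8 _
    have h9 : (S k x) ^ (1 / 6 : ℝ) ≤ q k ^ 1 * W x ^ (1 / 6 : ℝ) := by
      refine (ENNReal.rpow_le_rpow h7 (by norm_num)).trans_eq ?_
      rw [ENNReal.mul_rpow_of_nonneg _ _ (by norm_num), ← ENNReal.rpow_natCast,
        ← ENNReal.rpow_mul]
      norm_num
    have h10 : (S k x) ^ (1 / 6 : ℝ) ≤ N ^ (1 / 6 : ℝ) := ENNReal.rpow_le_rpow h6 (by norm_num)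
    rw [h5] at h1
    calc _ ≤ ENNReal.ofReal (D * (((μ ^ 4) ^ k)⁻¹) ^ 2) *
          (N ^ (1 / 6 : ℝ) * (q k ^ 1 * W x ^ (1 / 6 : ℝ)) * (V * q k ^ (8 + 0))) :=
          mul_le_mul_right (h1.trans (mul_le_mul_left (mul_le_mul' h10 h9) _)) _
      _ = (ENNReal.ofReal (D * (((μ ^ 4) ^ k)⁻¹) ^ 2) * q k ^ (8 + 0)) *
          (V * N ^ (1 / 6 : ℝ) * (q k ^ 1 * W x ^ (1 / 6 : ℝ))) := by ring
      _ = _ := by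
          rw [ofReal_inv_sq_mul hμ0 hD, pow_zero]
          ring
  refine ⟨hu.aestronglyMeasurable, ?_⟩
  rw [eLpNorm_lt_top_iff_lintegral_rpow_enorm_lt_top (by norm_num) (by norm_num)]
  have h6r : (6 : ℝ≥0∞).toReal = 6 := by norm_num
  rw [h6r]
  have h1 : ∀ᵐ x ∂ν, ‖u x‖ₑ ^ (6 : ℝ) ≤
      2 ^ ((6 : ℝ) - 1) * ((A : ℝ≥0∞) ^ (6 : ℝ) + c₂ ^ (6 : ℝ) * W x) := by
    filter_upwards [hux] with x hx
    refine (ENNReal.rpow_le_rpow hx (by norm_num)).trans ?_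
    refine (ENNReal.rpow_add_le_mul_rpow_add_rpow _ _ (by norm_num)).trans_eq ?_
    rw [ENNReal.mul_rpow_of_nonneg _ _ (by norm_num), ← ENNReal.rpow_mul (W x)]
    norm_num
  refine (lintegral_mono_ae h1).trans_lt ?_
  have h2 : (2 : ℝ≥0∞) ^ ((6 : ℝ) - 1) < ∞ :=
    ENNReal.rpow_lt_top_of_nonneg (by norm_num) (by norm_num)
  have hc6 : c₂ ^ (6 : ℝ) < ∞ := ENNReal.rpow_lt_top_of_nonneg (by norm_num) hc₂t.ne
  have hA6 : (A : ℝ≥0∞) ^ (6 : ℝ) < ∞ :=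
    ENNReal.rpow_lt_top_of_nonneg (by norm_num) ENNReal.coe_ne_top
  rw [lintegral_const_mul' _ _ h2.ne, lintegral_add_left measurable_const, lintegral_const,
    lintegral_const_mul' _ _ hc6.ne]
  exact ENNReal.mul_lt_top h2 (ENNReal.add_lt_top.2
    ⟨ENNReal.mul_lt_top hA6 (measure_lt_top _ _), ENNReal.mul_lt_top hc6 hWt⟩)

/-! ### The algebra `W^{2,3}` -/

section Jet

variable {Ω : Set E3} {u v : E3 → ℝ}

lemma MemW.congr_ae (hΩ : IsOpen Ω) {k : ℕ} {p : ℝ≥0∞} (hu : MemW Ω k p u)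
    (huv : u =ᵐ[volume.restrict Ω] v) : MemW Ω k p v := by
  refine ⟨(memLp_congr_ae huv).1 hu.1, fun γ hγ => ?_⟩
  obtain ⟨g, hg, hgp⟩ := hu.2 γ hγ
  exact ⟨g, hg.congr_ae hΩ huv Filter.EventuallyEq.rfl, hgp⟩

lemma integral_add_mul_test {g h φ : E3 → ℝ} (hg : Integrable g (volume.restrict Ω))
    (hh : Integrable h (volume.restrict Ω)) (hφ : IsTestFunction Ω φ) :
    ∫ x in Ω, (g x + h x) * φ x = (∫ x in Ω, g x * φ x) + ∫ x in Ω, h x * φ x := by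
  obtain ⟨C, hC⟩ := hφ.exists_bound
  rw [← integral_add (hg.mul_bdd hφ.1.continuous.aestronglyMeasurable
    (Filter.Eventually.of_forall hC)) (hh.mul_bdd hφ.1.continuous.aestronglyMeasurable
    (Filter.Eventually.of_forall hC))]
  exact integral_congr_ae (Filter.Eventually.of_forall fun x => add_mul _ _ _)

lemma IsWeakDeriv.add {i : Fin 3} {g h : E3 → ℝ} (hu : Integrable u (volume.restrict Ω))
    (hv : Integrable v (volume.restrict Ω)) (hg : Integrable g (volume.restrict Ω))
    (hh : Integrable h (volume.restrict Ω)) (hug : IsWeakDeriv Ω (Pi.single i 1) u g)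
    (hvh : IsWeakDeriv Ω (Pi.single i 1) v h) :
    IsWeakDeriv Ω (Pi.single i 1) (fun x => u x + v x) (fun x => g x + h x) := by
  refine isWeakDeriv_single_iff.2 ⟨hug.1.add hvh.1, hug.2.1.add hvh.2.1, fun φ hφ => ?_⟩
  rw [integral_add_mul_test hu hv (hφ.partialDeriv i), integral_add_mul_test hg hh hφ,
    (isWeakDeriv_single_iff.1 hug).2.2 φ hφ, (isWeakDeriv_single_iff.1 hvh).2.2 φ hφ]
  ring

lemma IsWeakDeriv.const_mul {i : Fin 3} {g : E3 → ℝ} (c : ℝ)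
    (hug : IsWeakDeriv Ω (Pi.single i 1) u g) :
    IsWeakDeriv Ω (Pi.single i 1) (fun x => c * u x) (fun x => c * g x) := by
  refine isWeakDeriv_single_iff.2 ⟨fun x hx => (hug.1 x hx).smul c, fun x hx => (hug.2.1 x hx).smul c,
    fun φ hφ => ?_⟩
  simp_rw [mul_assoc]
  rw [integral_const_mul, integral_const_mul, (isWeakDeriv_single_iff.1 hug).2.2 φ hφ]
  ring

/-- `g` and `G` are the first and second weak derivatives of `u`, with the integrability that
`u ∈ W^{2,3}` gives in a Lipschitz domain. -/
structure HasJet (Ω : Set E3) (u : E3 → ℝ) (g : Fin 3 → E3 → ℝ) (G : Fin 3 → Fin 3 → E3 → ℝ) :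
    Prop where
  memLp_top : MemLp u ∞ (volume.restrict Ω)
  memLp_six : ∀ i, MemLp (g i) 6 (volume.restrict Ω)
  memLp_three : ∀ i j, MemLp (G i j) 3 (volume.restrict Ω)
  deriv : ∀ i, IsWeakDeriv Ω (Pi.single i 1) u (g i)
  deriv_deriv : ∀ i j, IsWeakDeriv Ω (Pi.single j 1) (g i) (G i j)

/-- The first derivatives have gradients in `L³`, hence lie in `L⁶`; then `u` itself has its
gradient in `L⁶`, hence is bounded. -/
lemma MemW.exists_hasJet (hΩ : IsOpen Ω) (hbd : Bornology.IsBounded Ω)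
    (hL : HasLipschitzBoundary Ω) (hu : MemW Ω 2 3 u) : ∃ g G, HasJet Ω u g G := by
  have hfin : IsFiniteMeasure (volume.restrict Ω) := ⟨by simpa using hbd.measure_lt_top⟩
  choose g hg hg3 using fun i : Fin 3 => hu.2 (Pi.single i 1) (by rw [sum_single]; norm_num)
  choose G hG hG3 using fun i j : Fin 3 =>
    hu.2 (Pi.single i 1 + Pi.single j 1) (sum_single_add_single i j).le
  have hGw : ∀ i j, IsWeakDeriv Ω (Pi.single j 1) (g i) (G i j) := fun i j =>
    (isWeakDeriv_single_add_single_iff (hg i)).1 (hG i j)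
  have hg6 : ∀ i, MemLp (g i) 6 (volume.restrict Ω) := fun i =>
    memLp_six_of_weakDeriv_memLp_three hΩ hbd hL ((hg3 i).integrable (by norm_num)) (hG3 i)
      (hGw i)
  exact ⟨g, G, memLp_top_of_weakDeriv_memLp_six hΩ hbd hL (hu.1.integrable (by norm_num)) hg6 hg,
    hg6, hG3, hg, hGw⟩

namespace HasJet

variable {g h : Fin 3 → E3 → ℝ} {G H : Fin 3 → Fin 3 → E3 → ℝ}

lemma second (hu : HasJet Ω u g G) (i j : Fin 3) :
    IsWeakDeriv Ω (Pi.single i 1 + Pi.single j 1) u (G i j) :=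
  (isWeakDeriv_single_add_single_iff (hu.deriv i)).2 (hu.deriv_deriv i j)

lemma memW [IsFiniteMeasure (volume.restrict Ω)] (hu : HasJet Ω u g G) : MemW Ω 2 3 u := by
  have hu3 : MemLp u 3 (volume.restrict Ω) := hu.memLp_top.mono_exponent le_top
  refine ⟨hu3, fun γ hγ => ?_⟩
  have hcases : ∑ i, γ i = 0 ∨ ∑ i, γ i = 1 ∨ ∑ i, γ i = 2 := by omega
  rcases hcases with h0 | h1 | h2
  · rw [eq_zero_of_sum_eq_zero h0]
    exact ⟨u, isWeakDeriv_zero (MemLp.locallyIntegrableOn (by norm_num) hu3), hu3⟩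
  · obtain ⟨i, rfl⟩ := exists_eq_single h1
    exact ⟨g i, hu.deriv i, (hu.memLp_six i).mono_exponent (by norm_num)⟩
  · obtain ⟨i, j, rfl⟩ := exists_eq_single_add_single h2
    exact ⟨G i j, hu.second i j, hu.memLp_three i j⟩

lemma add [IsFiniteMeasure (volume.restrict Ω)] (hu : HasJet Ω u g G) (hv : HasJet Ω v h H) :
    HasJet Ω (fun x => u x + v x) (fun i x => g i x + h i x)
      (fun i j x => G i j x + H i j x) where
  memLp_top := hu.memLp_top.add hv.memLp_top
  memLp_six i := (hu.memLp_six i).add (hv.memLp_six i)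
  memLp_three i j := (hu.memLp_three i j).add (hv.memLp_three i j)
  deriv i := (hu.deriv i).add (hu.memLp_top.integrable le_top) (hv.memLp_top.integrable le_top)
    ((hu.memLp_six i).integrable (by norm_num)) ((hv.memLp_six i).integrable (by norm_num))
    (hv.deriv i)
  deriv_deriv i j := (hu.deriv_deriv i j).add ((hu.memLp_six i).integrable (by norm_num))
    ((hv.memLp_six i).integrable (by norm_num)) ((hu.memLp_three i j).integrable (by norm_num))
    ((hv.memLp_three i j).integrable (by norm_num)) (hv.deriv_deriv i j)

lemma const_mul (hu : HasJet Ω u g G) (c : ℝ) :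
    HasJet Ω (fun x => c * u x) (fun i x => c * g i x) (fun i j x => c * G i j x) where
  memLp_top := hu.memLp_top.const_mul c
  memLp_six i := (hu.memLp_six i).const_mul c
  memLp_three i j := (hu.memLp_three i j).const_mul c
  deriv i := (hu.deriv i).const_mul c
  deriv_deriv i j := (hu.deriv_deriv i j).const_mul c

end HasJet

instance holderTriple_six_six_three : ENNReal.HolderTriple 6 6 3 where
  inv_add_inv_eq_inv := by
    rw [← two_mul, ← div_eq_mul_inv, ENNReal.div_eq_inv_mul, show (6 : ℝ≥0∞) = 3 * 2 by norm_num,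
      ENNReal.mul_inv (by norm_num) (by norm_num), mul_assoc,
      ENNReal.inv_mul_cancel (by norm_num) (by norm_num), mul_one]

/-- Leibniz is applied to `u v`, then to both products in its derivative. Each weak product rule
needs only `L²` factors, while the integrability of the result uses the stronger exponents. -/
lemma HasJet.mul (hΩ : IsOpen Ω) (hbd : Bornology.IsBounded Ω)
    {g h : Fin 3 → E3 → ℝ} {G H : Fin 3 → Fin 3 → E3 → ℝ}
    (hu : HasJet Ω u g G) (hv : HasJet Ω v h H) :
    HasJet Ω (fun x => u x * v x) (fun i x => g i x * v x + u x * h i x)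
      (fun i j x => (G i j x * v x + g i x * h j x) + (g j x * h i x + u x * H i j x)) := by
  have hfin : IsFiniteMeasure (volume.restrict Ω) := ⟨by simpa using hbd.measure_lt_top⟩
  have hvol : volume Ω ≠ ∞ := hbd.measure_lt_top.ne
  have hu2 : MemLp u 2 (volume.restrict Ω) := hu.memLp_top.mono_exponent le_top
  have hv2 : MemLp v 2 (volume.restrict Ω) := hv.memLp_top.mono_exponent le_top
  have hg2 : ∀ i, MemLp (g i) 2 (volume.restrict Ω) := fun i =>
    (hu.memLp_six i).mono_exponent (by norm_num)
  have hh2 : ∀ i, MemLp (h i) 2 (volume.restrict Ω) := fun i =>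
    (hv.memLp_six i).mono_exponent (by norm_num)
  have hG2 : ∀ i j, MemLp (G i j) 2 (volume.restrict Ω) := fun i j =>
    (hu.memLp_three i j).mono_exponent (by norm_num)
  have hH2 : ∀ i j, MemLp (H i j) 2 (volume.restrict Ω) := fun i j =>
    (hv.memLp_three i j).mono_exponent (by norm_num)
  have m1 : ∀ i j, MemLp (fun x => G i j x * v x + g i x * h j x) 3 (volume.restrict Ω) :=
    fun i j => (hv.memLp_top.mul (hu.memLp_three i j)).add
      ((hv.memLp_six j).mul (hu.memLp_six i))
  have m2 : ∀ i j, MemLp (fun x => g j x * h i x + u x * H i j x) 3 (volume.restrict Ω) :=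
    fun i j => ((hv.memLp_six i).mul (hu.memLp_six j)).add
      ((hv.memLp_three i j).mul hu.memLp_top)
  refine ⟨hv.memLp_top.mul hu.memLp_top, fun i => (hv.memLp_top.mul (hu.memLp_six i)).add
    ((hv.memLp_six i).mul hu.memLp_top), fun i j => (m1 i j).add (m2 i j),
    fun i => IsWeakDeriv.mul hΩ hvol hu2 hv2 (hg2 i) (hh2 i) (hu.deriv i) (hv.deriv i),
    fun i j => ?_⟩
  exact IsWeakDeriv.add ((hg2 i).integrable_mul hv2) (hu2.integrable_mul (hh2 i))
    ((m1 i j).integrable (by norm_num)) ((m2 i j).integrable (by norm_num))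
    (IsWeakDeriv.mul hΩ hvol (hg2 i) hv2 (hG2 i j) (hh2 j) (hu.deriv_deriv i j) (hv.deriv j))
    (IsWeakDeriv.mul hΩ hvol hu2 (hh2 i) (hg2 j) (hH2 i j) (hu.deriv j) (hv.deriv_deriv i j))

lemma eLpNorm_mul_le {p q r : ℝ≥0∞} [ENNReal.HolderTriple p q r] {ν : Measure E3}
    (hu : AEStronglyMeasurable u ν) (hv : AEStronglyMeasurable v ν) :
    eLpNorm (fun x => u x * v x) r ν ≤ eLpNorm u p ν * eLpNorm v q ν :=
  eLpNorm_smul_le_mul_eLpNorm (φ := u) (f := v) hv hu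

/-- The `L³` bound for the second derivatives of a product. -/
lemma HasJet.eLpNorm_mul_second_le {g h : Fin 3 → E3 → ℝ} {G H : Fin 3 → Fin 3 → E3 → ℝ}
    (hu : HasJet Ω u g G) (hv : HasJet Ω v h H) {X Y Z : ℝ≥0∞}
    (huX : eLpNorm u ∞ (volume.restrict Ω) ≤ X) (hvX : eLpNorm v ∞ (volume.restrict Ω) ≤ X)
    (hgY : ∀ i, eLpNorm (g i) 6 (volume.restrict Ω) ≤ Y)
    (hhY : ∀ i, eLpNorm (h i) 6 (volume.restrict Ω) ≤ Y)
    (hGZ : ∀ i j, eLpNorm (G i j) 3 (volume.restrict Ω) ≤ Z)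
    (hHZ : ∀ i j, eLpNorm (H i j) 3 (volume.restrict Ω) ≤ Z) (i j : Fin 3) :
    eLpNorm (fun x => (G i j x * v x + g i x * h j x) + (g j x * h i x + u x * H i j x)) 3
      (volume.restrict Ω) ≤ 2 * (Y ^ 2 + X * Z) := by
  have a1 := hu.memLp_top.1
  have a2 := hv.memLp_top.1
  have a3 := fun i => (hu.memLp_six i).1
  have a4 := fun i => (hv.memLp_six i).1
  have a5 := fun i j => (hu.memLp_three i j).1
  have a6 := fun i j => (hv.memLp_three i j).1
  have b1 := (eLpNorm_mul_le (p := 3) (q := ∞) (r := 3) (a5 i j) a2).trans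
    (mul_le_mul' (hGZ i j) hvX)
  have b2 := (eLpNorm_mul_le (p := 6) (q := 6) (r := 3) (a3 i) (a4 j)).trans
    (mul_le_mul' (hgY i) (hhY j))
  have b3 := (eLpNorm_mul_le (p := 6) (q := 6) (r := 3) (a3 j) (a4 i)).trans
    (mul_le_mul' (hgY j) (hhY i))
  have b4 := (eLpNorm_mul_le (p := ∞) (q := 3) (r := 3) a1 (a6 i j)).trans
    (mul_le_mul' huX (hHZ i j))
  have c1 := (eLpNorm_add_le (p := 3) ((a5 i j).mul a2) ((a3 i).mul (a4 j)) (by norm_num)).trans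
    (add_le_add b1 b2)
  have c2 := (eLpNorm_add_le (p := 3) ((a3 j).mul (a4 i)) (a1.mul (a6 i j)) (by norm_num)).trans
    (add_le_add b3 b4)
  refine ((eLpNorm_add_le (p := 3) (((a5 i j).mul a2).add ((a3 i).mul (a4 j)))
    (((a3 j).mul (a4 i)).add (a1.mul (a6 i j))) (by norm_num)).trans
    (add_le_add c1 c2)).trans_eq ?_
  ring

end Jet

/-! ### Norms of families -/

section Family

variable {Ω : Set E3} {ι : Type} [Fintype ι] {f : ι → E3 → ℝ}

lemma eLpNorm_le_familyNorm {p : ℝ≥0∞} (hp : p ≠ 0) (i : ι) :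
    eLpNorm (f i) p (volume.restrict Ω) ≤ familyNorm Ω p f := by
  rw [familyNorm]
  split_ifs with hp'
  · subst hp'
    exact le_iSup (fun i => eLpNorm (f i) ∞ (volume.restrict Ω)) i
  · have h0 : 0 < p.toReal := ENNReal.toReal_pos hp hp'
    rw [one_div, ENNReal.le_rpow_inv_iff h0]
    exact Finset.single_le_sum (f := fun i => eLpNorm (f i) p (volume.restrict Ω) ^ p.toReal)
      (fun _ _ => zero_le) (Finset.mem_univ i)

lemma familyNorm_lt_top {p : ℝ≥0∞}
    (h : ∀ i, eLpNorm (f i) p (volume.restrict Ω) < ∞) : familyNorm Ω p f < ∞ := by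
  rw [familyNorm]
  split_ifs with hp'
  · subst hp'
    refine lt_of_le_of_lt (iSup_le fun i => Finset.single_le_sum
      (f := fun i => eLpNorm (f i) ∞ (volume.restrict Ω)) (fun _ _ => zero_le)
      (Finset.mem_univ i)) (ENNReal.sum_lt_top.2 fun i _ => h i)
  · refine ENNReal.rpow_lt_top_of_nonneg (by positivity) (ENNReal.sum_lt_top.2 fun i _ => ?_).ne
    exact ENNReal.rpow_lt_top_of_nonneg (by positivity) (h i).ne

lemma familyNorm_three_le {X : ℝ≥0∞}
    (h : ∀ i, eLpNorm (f i) 3 (volume.restrict Ω) ≤ X) :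
    familyNorm Ω 3 f ≤ Fintype.card ι * X := by
  rw [familyNorm, if_neg (by norm_num)]
  have h3 : (3 : ℝ≥0∞).toReal = 3 := by norm_num
  rw [h3, one_div, ENNReal.rpow_inv_le_iff (by norm_num)]
  have h1 : ∑ i, eLpNorm (f i) 3 (volume.restrict Ω) ^ (3 : ℝ) ≤ Fintype.card ι * X ^ (3 : ℝ) := by
    refine (Finset.sum_le_card_nsmul _ _ _ fun i _ =>
      ENNReal.rpow_le_rpow (h i) (by norm_num)).trans_eq ?_
    rw [nsmul_eq_mul, Finset.card_univ]
  refine h1.trans ?_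
  rw [ENNReal.mul_rpow_of_nonneg _ _ (by norm_num)]
  refine mul_le_mul_left ?_ _
  have h4 : ((Fintype.card ι : ℕ) : ℝ≥0∞) ^ (3 : ℝ) = ((Fintype.card ι ^ 3 : ℕ) : ℝ≥0∞) := by
    rw [Nat.cast_pow, ← ENNReal.rpow_natCast]
    norm_num
  rw [h4]
  -- The sharp factor is the cube root of the cardinality; it is replaced by the cardinality itself.
  exact Nat.cast_le.2 (Nat.le_self_pow (by norm_num) _)

end Family

/-! ### The inverse of a unimodular tensor field -/

/-- Indices are added modulo 3, and cyclic ordering absorbs the cofactor signs, so one formula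
covers all nine entries. -/
lemma adjugate_apply_cyclic (A : Mat3) (i j : Fin 3) :
    A.adjugate i j = A (j + 1) (i + 1) * A (j + 2) (i + 2) +
      (-1) * (A (j + 1) (i + 2) * A (j + 2) (i + 1)) := by
  rw [Matrix.adjugate_fin_three]
  fin_cases i <;> fin_cases j <;> simp <;> ring

lemma inv_eq_adjugate {A : Mat3} (h : A.det = 1) : A⁻¹ = A.adjugate := by
  rw [Matrix.inv_def, h, Ring.inverse_one, one_smul]

end TensorSobolev

/-! ### The estimate for the inverse and the constitutive tensor. -/

open TensorSobolev in
theorem mainTheorem11 :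
    ∃ c : ℝ≥0, ∀ Ω : Set TensorSobolev.E3,
      IsOpen Ω → IsConnected Ω → Bornology.IsBounded Ω → TensorSobolev.HasLipschitzBoundary Ω →
      ∀ B : TensorSobolev.E3 → TensorSobolev.Mat3,
        TensorSobolev.MemWTensor Ω 2 3 B →
        (∀ᵐ x ∂(volume.restrict Ω), (B x).det = 1) →
        TensorSobolev.MemWTensor Ω 2 3 (fun x => (B x)⁻¹) ∧
        TensorSobolev.derivNorm Ω 1 6 B < ∞ ∧
        TensorSobolev.tensorNorm Ω ∞ B < ∞ ∧
        TensorSobolev.derivNorm Ω 2 3 B < ∞ ∧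
        TensorSobolev.derivNorm Ω 2 3 (fun x => (B x)⁻¹) ≤
          c * (TensorSobolev.derivNorm Ω 1 6 B ^ 2 +
            TensorSobolev.tensorNorm Ω ∞ B * TensorSobolev.derivNorm Ω 2 3 B) ∧
        ∀ μ₁ μ₂ μ₃ : TensorSobolev.E3 → ℝ,
          TensorSobolev.MemW Ω 1 ∞ μ₁ → TensorSobolev.MemW Ω 2 3 μ₁ →
          TensorSobolev.MemW Ω 1 ∞ μ₂ → TensorSobolev.MemW Ω 2 3 μ₂ →
          TensorSobolev.MemW Ω 1 ∞ μ₃ → TensorSobolev.MemW Ω 2 3 μ₃ →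
          TensorSobolev.MemWTensor Ω 2 3 (TensorSobolev.calA μ₁ μ₂ μ₃ B) := by
  -- Each second derivative of an entry of the adjugate costs `4`: two products, each with factor
  -- `2`. The cardinality comes from summing over entries and multi-indices.
  refine ⟨(Fintype.card ((Fin 3 × Fin 3) ×
    (Finset.piAntidiag Finset.univ 2 : Finset (Fin 3 → ℕ))) : ℝ≥0) * 4,
    fun Ω hΩ _ hbd hL B hB hdet => ?_⟩
  have hfin : IsFiniteMeasure (volume.restrict Ω) := ⟨by simpa using hbd.measure_lt_top⟩
  choose g G hJ using fun i j => (hB i j).exists_hasJet hΩ hbd hL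
  have hJmul := fun a b a' b' => (hJ a b).mul hΩ hbd (hJ a' b')
  have hJinv := fun i j : Fin 3 => (hJmul (j + 1) (i + 1) (j + 2) (i + 2)).add
    ((hJmul (j + 1) (i + 2) (j + 2) (i + 1)).const_mul (-1))
  -- Only almost everywhere equality holds, and it suffices: membership and weak derivatives do not
  -- see the null set where `det B ≠ 1`.
  have hinv : ∀ i j, (fun x => B x (j + 1) (i + 1) * B x (j + 2) (i + 2) +
      (-1) * (B x (j + 1) (i + 2) * B x (j + 2) (i + 1))) =ᵐ[volume.restrict Ω]
      fun x => (B x)⁻¹ i j := by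
    intro i j
    filter_upwards [hdet] with x hx
    rw [inv_eq_adjugate hx, adjugate_apply_cyclic]
  have hfirst : ∀ (e : Finset.piAntidiag Finset.univ 1), ∃ i : Fin 3,
      (e : Fin 3 → ℕ) = Pi.single i 1 := fun e =>
    exists_eq_single (Finset.mem_piAntidiag.1 e.2).1
  have hsecond : ∀ (e : Finset.piAntidiag Finset.univ 2), ∃ i j : Fin 3,
      (e : Fin 3 → ℕ) = Pi.single i 1 + Pi.single j 1 := fun e =>
    exists_eq_single_add_single (Finset.mem_piAntidiag.1 e.2).1
  refine ⟨fun i j => (hJinv i j).memW.congr_ae hΩ (hinv i j), ?_, ?_, ?_, ?_, ?_⟩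
  · refine familyNorm_lt_top fun e => ?_
    obtain ⟨i, hi⟩ := hfirst e.2
    rw [hi, eLpNorm_congr_ae (((hJ e.1.1 e.1.2).deriv i).weakDeriv_ae_eq hΩ)]
    exact ((hJ e.1.1 e.1.2).memLp_six i).2
  · exact familyNorm_lt_top fun e => (hJ e.1 e.2).memLp_top.2
  · refine familyNorm_lt_top fun e => ?_
    obtain ⟨i, j, hij⟩ := hsecond e.2
    rw [hij, eLpNorm_congr_ae (((hJ e.1.1 e.1.2).second i j).weakDeriv_ae_eq hΩ)]
    exact ((hJ e.1.1 e.1.2).memLp_three i j).2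
  · set X := tensorNorm Ω ∞ B with hX
    set Y := derivNorm Ω 1 6 B with hY
    set Z := derivNorm Ω 2 3 B with hZ
    have hXle : ∀ a b, eLpNorm (fun x => B x a b) ∞ (volume.restrict Ω) ≤ X := fun a b =>
      eLpNorm_le_familyNorm (f := fun (e : Fin 3 × Fin 3) x => B x e.1 e.2)
        ENNReal.top_ne_zero (a, b)
    have hYle : ∀ a b i, eLpNorm (g a b i) 6 (volume.restrict Ω) ≤ Y := by
      intro a b i
      rw [← eLpNorm_congr_ae (((hJ a b).deriv i).weakDeriv_ae_eq hΩ)]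
      exact eLpNorm_le_familyNorm (f := fun e : (Fin 3 × Fin 3) ×
        (Finset.piAntidiag Finset.univ 1 : Finset (Fin 3 → ℕ)) =>
        weakDeriv Ω e.2 (fun x => B x e.1.1 e.1.2)) (by norm_num)
        ((a, b), ⟨Pi.single i 1, Finset.mem_piAntidiag.2 ⟨sum_single i, by simp⟩⟩)
    have hZle : ∀ a b i j, eLpNorm (G a b i j) 3 (volume.restrict Ω) ≤ Z := by
      intro a b i j
      rw [← eLpNorm_congr_ae (((hJ a b).second i j).weakDeriv_ae_eq hΩ)]
      exact eLpNorm_le_familyNorm (f := fun e : (Fin 3 × Fin 3) ×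
        (Finset.piAntidiag Finset.univ 2 : Finset (Fin 3 → ℕ)) =>
        weakDeriv Ω e.2 (fun x => B x e.1.1 e.1.2)) (by norm_num)
        ((a, b), ⟨Pi.single i 1 + Pi.single j 1,
          Finset.mem_piAntidiag.2 ⟨sum_single_add_single i j, by simp⟩⟩)
    have hprod := fun a b a' b' => (hJ a b).eLpNorm_mul_second_le (hJ a' b') (hXle a b)
      (hXle a' b') (hYle a b) (hYle a' b') (hZle a b) (hZle a' b')
    have hcomp : ∀ e : (Fin 3 × Fin 3) × (Finset.piAntidiag Finset.univ 2 : Finset (Fin 3 → ℕ)),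
        eLpNorm (weakDeriv Ω e.2 (fun x => (B x)⁻¹ e.1.1 e.1.2)) 3 (volume.restrict Ω) ≤
          4 * (Y ^ 2 + X * Z) := by
      rintro ⟨⟨a, b⟩, e⟩
      obtain ⟨i, j, hij⟩ := hsecond e
      have hw := ((hJinv a b).second i j).congr_ae hΩ (hinv a b) Filter.EventuallyEq.rfl
      simp only
      rw [hij, eLpNorm_congr_ae (hw.weakDeriv_ae_eq hΩ)]
      have h1 := hprod (b + 1) (a + 1) (b + 2) (a + 2) i j
      have h2 := hprod (b + 1) (a + 2) (b + 2) (a + 1) i j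
      have h3 := (((hJmul (b + 1) (a + 2) (b + 2) (a + 1)).const_mul (-1)).memLp_three i j).1
      refine (eLpNorm_add_le ((hJmul (b + 1) (a + 1) (b + 2) (a + 2)).memLp_three i j).1 h3
        (by norm_num)).trans ?_
      have h4 : (4 : ℝ≥0∞) * (Y ^ 2 + X * Z) = 2 * (Y ^ 2 + X * Z) + 2 * (Y ^ 2 + X * Z) := by
        ring
      rw [h4]
      refine add_le_add h1 ?_
      simp only [neg_one_mul]
      exact (eLpNorm_neg _ _ _).trans_le h2
    refine (familyNorm_three_le hcomp).trans_eq ?_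
    push_cast
    ring
  · intro μ₁ μ₂ μ₃ _ h₁ _ h₂ _ h₃ i j
    obtain ⟨g₁, G₁, j₁⟩ := h₁.exists_hasJet hΩ hbd hL
    obtain ⟨g₂, G₂, j₂⟩ := h₂.exists_hasJet hΩ hbd hL
    obtain ⟨g₃, G₃, j₃⟩ := h₃.exists_hasJet hΩ hbd hL
    -- Each entry of `𝒜(B)` is a sum of products of functions with jets, the identity contributing
    -- constants.
    refine (((j₁.const_mul ((1 : Mat3) i j)).add (j₂.mul hΩ hbd (hJ i j))).add
      (j₃.mul hΩ hbd (hJinv i j))).memW.congr_ae hΩ ?_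
    filter_upwards [hinv i j] with x hx
    rw [hx, mul_comm ((1 : Mat3) i j)]
    rfl
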